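/- Setting. Let $m,n\ge 1$. The $m\times n$ Bacon–Shor code has qubits $(i,j)$, $0\le i<m$, $0\le j<n$. In the $Z$-gauge it is the stabilizer code generated by all $Z_{i,j-1}Z_{i,j}$ ($0\le i<m$, $1\le j<n$) and all $\prod_{j}X_{i-1,j}X_{i,j}$ ($1\le i<m$), with logical operator $\bar Z=\prod_i Z_{i,0}$. Take three such blocks. Let $s_k$ be the stabilizer generators of the three blocks, $P_\alpha=\prod_k\frac{I+(-1)^{\alpha_k}s_k}{2}$ the projector onto syndrome $\alpha$, and $P=P_0$ the projector onto the codespace. A CCZ-form circuit is a sequence of timesteps, each a set of CCZ gates with disjoint supports, where each gate acts on one qubit from each block. It implements $\overline{\mathrm{CCZ}}$ if its unitary $U$ satisfies $UP=\overline{\mathrm{CCZ}}\,P$, where $\overline{\mathrm{CCZ}}=I-2\prod_{b=1}^3\frac{I-\bar Z_b}{2}$. Circuit depolarizing noise of strength $p=\epsilon^2$: independently, each gate fails with probability $p$, in which case it is followed by one of the 63 non-identity Pauli operators on its three qubits, each with probability $p/63$. For a fault pattern $f$, let $U_f$ be the operator performed by the circuit with these Pauli errors inserted. The noise is then the channel on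 the output of the ideal circuit with Kraus operators $E_f(\epsilon)=\sqrt{\Pr[f]}\;U_fU^\dagger$. The circuit is fault-tolerant against circuit depolarizing noise using stabilizer projective recovery if this noise is correctable with effective distance $m$ (which is the code distance when $n\ge m$), that is, if there are Hermitian matrices $\gamma^{(\alpha)}(\epsilon)$ such that for all $\alpha,i,j$ $$P\,E_i(\epsilon)^\dagger P_\alpha E_j(\epsilon)\,P=\gamma^{(\alpha)}_{ij}(\epsilon)\,P+O(\epsilon^m)\qquad(\epsilon\to0^+).$$ Theorem. (a) If $n\ge m$ and $n\ge\lceil m/2\rceil^2$, then there is a CCZ-form circuit, in which no gate is repeated, that implements $\overline{\mathrm{CCZ}}$ on three $m\times n$ Bacon–Shor codes in the $Z$-gauge and is fault-tolerant against circuit depolarizing noise using stabilizer projective recovery. (The condition $n\ge m$ follows from $n\ge\lceil m/2\rceil^2$ except when $(m,n)=(2,1)$.) (b) If there is a CCZ-form circuit, with or without repeated gates, that implements $\overline{\mathrm{CCZ}}$ on three $m\times n$ Bacon–Shor codes in the $Z$-gauge and is fault-tolerant in this sense, then $n\ge\lceil m^2/4\rceil$. -/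

import Mathlib

open Filter Topology Asymptotics

noncomputable section

namespace BaconShor

/-- The physical qubits of three `m × n` codeblocks: `(b, i, j)` is the qubit in row `i` and
column `j` of block `b`. -/
abbrev Qubit (m n : ℕ) : Type := Fin 3 × Fin m × Fin n

/-- Operators on the Hilbert space of all qubits of the three blocks, as matrices in the
computational basis; a basis state assigns a bit to every qubit. -/
abbrev Op (m n : ℕ) : Type := Matrix (Qubit m n → Fin 2) (Qubit m n → Fin 2) ℂ

/-- The single-qubit Pauli matrices, labelled `0, 1, 2, 3` for `I, X, Y, Z`. -/
def pauliMatrix : Fin 4 → Matrix (Fin 2) (Fin 2) ℂ :=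
  ![1, !![0, 1; 1, 0], !![0, -Complex.I; Complex.I, 0], !![1, 0; 0, -1]]

/-- The tensor product over all qubits `q` of the Pauli matrices labelled `v q`. -/
def pauliOp {m n : ℕ} (v : Qubit m n → Fin 4) : Op m n :=
  Matrix.of fun s t => ∏ q, pauliMatrix (v q) (s q) (t q)

/-! ### The code: three Bacon-Shor blocks in the `Z`-gauge -/

/-- Index set of the stabilizer generators: in each block, the `Z`-gauge operators
(a row and a pair of adjacent columns) and the `X`-type stabilizers (a pair of adjacent rows). -/
abbrev Gen (m n : ℕ) : Type := Fin 3 × ((Fin m × Fin (n - 1)) ⊕ Fin (m - 1))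

/-- The stabilizer generators of three `Z`-gauge Bacon-Shor blocks: `Z_{i,j} Z_{i,j+1}`, and the
product of all `X` in the two rows `i` and `i + 1`. -/
def stabilizer {m n : ℕ} : Gen m n → Op m n
  | (b, Sum.inl (i, j)) =>
      pauliOp fun q => if q.1 = b ∧ q.2.1 = i ∧ (q.2.2.val = j.val ∨ q.2.2.val = j.val + 1)
        then 3 else 0
  | (b, Sum.inr i) =>
      pauliOp fun q => if q.1 = b ∧ (q.2.1.val = i.val ∨ q.2.1.val = i.val + 1) then 1 else 0

/-- The projector `P_α = ∏_k (I + (-1)^{α_k} s_k) / 2` onto the states with syndrome `α`.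
The factors commute, so the order of the list does not matter. -/
def syndromeProj {m n : ℕ} (α : Gen m n → Fin 2) : Op m n :=
  ((Finset.univ : Finset (Gen m n)).toList.map fun k =>
    (2⁻¹ : ℂ) • ((1 : Op m n) + ((-1 : ℂ) ^ (α k).val) • stabilizer k)).prod

/-- The projector `P` onto the codespace. -/
def codeProj (m n : ℕ) : Op m n := syndromeProj fun _ => 0

/-- The logical operator `Z̄` of block `b`: the product of the `Z` in column `0`. -/
def logicalZ (m n : ℕ) [NeZero n] (b : Fin 3) : Op m n :=
  pauliOp fun q => if q.1 = b ∧ q.2.2 = 0 then 3 else 0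

/-- The logical CCZ gate on the three blocks: `I - 2 ∏_b (I - Z̄_b) / 2`. -/
def logicalCCZ (m n : ℕ) [NeZero n] : Op m n :=
  1 - (2 : ℂ) • (((2⁻¹ : ℂ) • (1 - logicalZ m n 0)) * ((2⁻¹ : ℂ) • (1 - logicalZ m n 1)) *
    ((2⁻¹ : ℂ) • (1 - logicalZ m n 2)))

/-! ### CCZ-form circuits -/

/-- A CCZ gate with one qubit in each block: it acts on the qubits `(b, g b)`. -/
abbrev CCZGate (m n : ℕ) : Type := Fin 3 → Fin m × Fin n

/-- The unitary of a CCZ gate. -/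
def cczOp {m n : ℕ} (g : CCZGate m n) : Op m n :=
  Matrix.diagonal fun s => if ∀ b, s (b, g b) = 1 then -1 else 1

/-- The Pauli operator on the support of the gate `g` that is labelled by `e b` on the
qubit of `g` in block `b`. -/
def gatePauli {m n : ℕ} (g : CCZGate m n) (e : Fin 3 → Fin 4) : Op m n :=
  pauliOp fun q => if g q.1 = q.2 then e q.1 else 0

/-- A CCZ-form circuit on the three blocks: a sequence of timesteps, each of which is a set of
CCZ gates with disjoint supports. -/
structure CCZCircuit (m n : ℕ) where
  depth : ℕ
  step : Fin depth → Finset (CCZGate m n)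
  disjoint : ∀ t, ∀ g ∈ step t, ∀ g' ∈ step t, g ≠ g' → ∀ b, g b ≠ g' b

namespace CCZCircuit

variable {m n : ℕ} (C : CCZCircuit m n)

/-- No CCZ gate occurs in two different timesteps. -/
def NoRepeatedGate : Prop :=
  ∀ t t' : Fin C.depth, t ≠ t' → Disjoint (C.step t) (C.step t')

/-- The locations of the circuit at which a fault can occur: its gates. -/
abbrev Loc : Type := Σ t : Fin C.depth, {g : CCZGate m n // g ∈ C.step t}

/-- A fault pattern assigns to every gate the Pauli error that follows it; the label `0`
(the identity) means that the gate does not fail. -/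
abbrev FaultPattern : Type := C.Loc → Fin 3 → Fin 4

/-- The operator performed by the circuit when every gate is followed by the Pauli error that the
fault pattern prescribes. Later timesteps stand on the left; the order of the gates in one
timestep does not matter, since their supports are disjoint. -/
def faultyOp (f : C.FaultPattern) : Op m n :=
  (List.ofFn fun t : Fin C.depth =>
    ((Finset.univ : Finset {g : CCZGate m n // g ∈ C.step t}).toList.map fun g =>
      gatePauli g.1 (f ⟨t, g⟩) * cczOp g.1).prod).reverse.prod

/-- The unitary of the ideal circuit. -/
def idealOp : Op m n := C.faultyOp 0

/-- The circuit acts on the codespace as logical CCZ. -/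
def ImplementsLogicalCCZ [NeZero n] : Prop :=
  C.idealOp * codeProj m n = logicalCCZ m n * codeProj m n

/-- The amplitude of a fault pattern under circuit depolarizing noise of strength `p`: each gate
fails independently with probability `p`, and then suffers each of the `63` non-identity Pauli
errors on its support with probability `p / 63`. -/
def amplitude (p : ℝ) (f : C.FaultPattern) : ℝ :=
  ∏ l, if f l = 0 then Real.sqrt (1 - p) else Real.sqrt (p / 63)

/-- The Kraus operators of the noise with error parameter `ε = √p`, as a channel on the output of
the ideal circuit: the Pauli errors of the fault pattern, propagated to the end of the circuit. -/
def kraus (ε : ℝ) (f : C.FaultPattern) : Op m n :=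
  ((C.amplitude (ε ^ 2) f : ℝ) : ℂ) • (C.faultyOp f * C.idealOp.conjTranspose)

/-- Circuit depolarizing noise is correctable with effective distance `d` using stabilizer
projective recovery: there are Hermitian matrices `γ^{(α)}(ε)` with
`P E_i(ε)† P_α E_j(ε) P = γ^{(α)}_{ij}(ε) P + O(ε ^ d)` as `ε → 0⁺`, for all `α, i, j`. -/
def HasEffectiveDistanceSPR (d : ℕ) : Prop :=
  ∃ γ : (Gen m n → Fin 2) → ℝ → Matrix C.FaultPattern C.FaultPattern ℂ,
    (∀ α ε, (γ α ε).IsHermitian) ∧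
    ∀ α i j s t,
      (fun ε : ℝ =>
        (codeProj m n * (C.kraus ε i).conjTranspose * syndromeProj α * C.kraus ε j * codeProj m n
          - γ α ε i j • codeProj m n) s t)
        =O[𝓝[>] (0 : ℝ)] fun ε : ℝ => ε ^ d

end CCZCircuit

end BaconShor

end

/-! In the computational basis CCZ gates are diagonal signs and Pauli errors are translations with
phases. A faulty circuit times the inverse of the ideal one is therefore a monomial operator, with
translation `flips f` and phase `relPhase f`. An `X` error spreads only by turning each later CCZ on
its qubit into a CZ on the other two qubits. A pair of fault patterns enters the correction
condition with order `ε` to the power of its total weight, so only total weight below `m` matters.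

(a) Group the rows of each block into pairs, use one gate per triple of rows, and let the column in
one block record the pairs met in the other two; `⌈m/2⌉²` columns suffice. Gates sharing a qubit
then meet the same pair of rows in each other block, so errors spread only within pairs. For two
patterns with different `Z` syndromes the condition is void; otherwise `n ≥ m` forces equal flips.
Counting faults pair by pair leaves in each block a row untouched by both patterns
(`PairLocal.exists_unaffected`). The logical `X` on that row commutes with both errors, and Schur's
lemma (`CommutesWithLogicals.eq_smul_codeProj`) gives the scalar.

(b) Compare an `X` error after the first and after the last gate on a qubit of block 0. The flips
agree, but the phases differ by CZs, which form a binary bilinear form `M` between the rows of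
blocks 1 and 2 (`spreadMatrix`); the CZ of the first gate itself is supplied as a linear combination
of `Z` errors on it. With up to `m - 3` further `Z` errors, correctability bounds by two the weights
in the row and column spaces of `M`, and in the column space also after one entry is changed. Such a
matrix has at most four ones (`card_ones_le_four`). The `n` qubits of one row must together cover
all `m²` pairs of rows, so `m² ≤ 4n`. -/

noncomputable section

namespace BaconShor

variable {m n : ℕ}

/-! ### Signs of bits -/

/-- The sign `(-1) ^ x` of a bit. -/
def sgn (x : Fin 2) : ℂ := if x = 0 then 1 else -1

@[simp] lemma sgn_zero : sgn 0 = 1 := rfl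

@[simp] lemma sgn_one : sgn 1 = -1 := rfl

lemma sgn_add (x y : Fin 2) : sgn (x + y) = sgn x * sgn y := by
  fin_cases x <;> fin_cases y <;> simp [sgn]

lemma sgn_mul_self (x : Fin 2) : sgn x * sgn x = 1 := by
  fin_cases x <;> simp [sgn]

@[simp] lemma star_sgn (x : Fin 2) : star (sgn x) = sgn x := by
  fin_cases x <;> simp [sgn]

lemma sgn_eq_one_iff {x : Fin 2} : sgn x = 1 ↔ x = 0 := by
  fin_cases x <;> norm_num [sgn]

lemma sgn_injective : Function.Injective sgn := by
  intro x y h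
  by_contra hxy
  fin_cases x <;> fin_cases y <;> first | exact hxy rfl | norm_num [sgn] at h

lemma sgn_sum {ι : Type*} (s : Finset ι) (f : ι → Fin 2) :
    sgn (∑ i ∈ s, f i) = ∏ i ∈ s, sgn (f i) := by
  classical
  induction s using Finset.induction_on with
  | empty => simp
  | insert a s ha ih => rw [Finset.sum_insert ha, Finset.prod_insert ha, sgn_add, ih]

lemma bit_add_self (x : Fin 2) : x + x = 0 := by
  fin_cases x <;> rfl

lemma bits_add_self {ι : Type*} (x : ι → Fin 2) : x + x = 0 :=
  funext fun i => bit_add_self (x i)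

lemma bits_add_add_cancel {ι : Type*} (x y : ι → Fin 2) : x + y + y = x := by
  rw [add_assoc, bits_add_self, add_zero]

lemma bits_eq_add_comm {ι : Type*} {x y z : ι → Fin 2} : x = y + z ↔ y = x + z :=
  ⟨fun h => by rw [h, bits_add_add_cancel], fun h => by rw [h, bits_add_add_cancel]⟩

lemma bit_ne_zero_iff {x : Fin 2} : x ≠ 0 ↔ x = 1 := by
  fin_cases x <;> simp

/-! ### Monomial operators -/

/-- A computational basis state: a bit for every qubit. -/
abbrev State (m n : ℕ) : Type := Qubit m n → Fin 2

/-- The operator sending the basis state `t` to `φ t` times the basis state `t + x`. -/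
def mono (x : State m n) (φ : State m n → ℂ) : Op m n :=
  Matrix.of fun s t => if s = t + x then φ t else 0

lemma mono_apply (x : State m n) (φ : State m n → ℂ) (s t : State m n) :
    mono x φ s t = if s = t + x then φ t else 0 := rfl

lemma mono_mul_apply (x : State m n) (φ : State m n → ℂ) (M : Op m n) (s t : State m n) :
    (mono x φ * M) s t = φ (s + x) * M (s + x) t := by
  rw [Matrix.mul_apply, Finset.sum_eq_single (s + x)]
  · simp [mono_apply, bits_add_add_cancel]
  · intro u _ hu
    rw [mono_apply, if_neg, zero_mul]
    rwa [bits_eq_add_comm]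
  · simp

lemma mul_mono_apply (x : State m n) (φ : State m n → ℂ) (M : Op m n) (s t : State m n) :
    (M * mono x φ) s t = M s (t + x) * φ t := by
  rw [Matrix.mul_apply, Finset.sum_eq_single (t + x)]
  · simp [mono_apply]
  · intro u _ hu
    rw [mono_apply, if_neg hu, mul_zero]
  · simp

lemma mono_mul_mono (x y : State m n) (φ ψ : State m n → ℂ) :
    mono x φ * mono y ψ = mono (x + y) fun t => φ (t + y) * ψ t := by
  ext s t
  rw [mul_mono_apply, mono_apply, mono_apply, add_comm x y, ← add_assoc, ite_mul, zero_mul]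

lemma one_eq_mono : (1 : Op m n) = mono 0 fun _ => 1 := by
  ext s t
  simp [mono_apply, Matrix.one_apply]

lemma diagonal_eq_mono (φ : State m n → ℂ) : Matrix.diagonal φ = mono 0 φ := by
  ext s t
  by_cases h : s = t <;> simp [mono_apply, h]

lemma mono_conjTranspose (x : State m n) (φ : State m n → ℂ) :
    (mono x φ).conjTranspose = mono x fun t => star (φ (t + x)) := by
  ext s t
  rw [Matrix.conjTranspose_apply, mono_apply, mono_apply]
  by_cases h : t = s + x
  · rw [if_pos h, if_pos (bits_eq_add_comm.1 h), h, bits_add_add_cancel]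
  · rw [if_neg h, if_neg (fun h' => h (bits_eq_add_comm.1 h')), star_zero]

lemma mono_mulVec_apply (x : State m n) (φ : State m n → ℂ) (v : State m n → ℂ) (s : State m n) :
    (mono x φ).mulVec v s = φ (s + x) * v (s + x) := by
  rw [Matrix.mulVec, dotProduct, Finset.sum_eq_single (s + x)]
  · simp [mono_apply, bits_add_add_cancel]
  · intro u _ hu
    rw [mono_apply, if_neg, zero_mul]
    rwa [bits_eq_add_comm]
  · simp

lemma smul_mono (c : ℂ) (x : State m n) (φ : State m n → ℂ) :
    c • mono x φ = mono x fun t => c * φ t := by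
  ext s t
  simp [mono_apply]

/-! ### Pauli operators as monomial operators -/

/-- The bit flipped by a Pauli matrix. -/
def xbit : Fin 4 → Fin 2 := ![0, 1, 1, 0]

/-- The phase that a Pauli matrix gives to a basis state. -/
def pphase (v : Fin 4) (t : Fin 2) : ℂ := pauliMatrix v (t + xbit v) t

lemma pauliMatrix_apply (v : Fin 4) (s t : Fin 2) :
    pauliMatrix v s t = if s = t + xbit v then pphase v t else 0 := by
  fin_cases v <;> fin_cases s <;> fin_cases t <;> simp [pauliMatrix, pphase, xbit]

@[simp] lemma pphase_zero (t : Fin 2) : pphase 0 t = 1 := by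
  simp [pphase, xbit, pauliMatrix]

@[simp] lemma pphase_one (t : Fin 2) : pphase 1 t = 1 := by
  fin_cases t <;> simp [pphase, xbit, pauliMatrix]

@[simp] lemma pphase_three (t : Fin 2) : pphase 3 t = sgn t := by
  fin_cases t <;> simp [pphase, xbit, pauliMatrix]

@[simp] lemma xbit_zero : xbit 0 = 0 := rfl

@[simp] lemma xbit_one : xbit 1 = 1 := rfl

@[simp] lemma xbit_three : xbit 3 = 0 := rfl

lemma pauliOp_eq_mono (v : Qubit m n → Fin 4) :
    pauliOp v = mono (fun q => xbit (v q)) fun t => ∏ q, pphase (v q) (t q) := by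
  ext s t
  rw [pauliOp, Matrix.of_apply, mono_apply]
  split_ifs with h
  · refine Finset.prod_congr rfl fun q _ => ?_
    exact (pauliMatrix_apply _ _ _).trans (if_pos (congrFun h q))
  · obtain ⟨q, hq⟩ : ∃ q, s q ≠ t q + xbit (v q) := by
      by_contra! h'
      exact h (funext h')
    refine Finset.prod_eq_zero (Finset.mem_univ q) ?_
    rw [pauliMatrix_apply, if_neg hq]

lemma pauliOp_z_eq_mono (p : Qubit m n → Prop) [DecidablePred p] :
    pauliOp (fun q => if p q then 3 else 0) = mono 0 fun t => ∏ q with p q, sgn (t q) := by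
  rw [pauliOp_eq_mono]
  congr 1
  · funext q
    by_cases h : p q <;> simp [h]
  · funext t
    rw [Finset.prod_filter]
    refine Finset.prod_congr rfl fun q _ => ?_
    by_cases h : p q <;> simp [h]

lemma pauliOp_x_eq_mono (p : Qubit m n → Prop) [DecidablePred p] :
    pauliOp (fun q => if p q then 1 else 0) = mono (fun q => if p q then 1 else 0) fun _ => 1 := by
  rw [pauliOp_eq_mono]
  congr 1
  · funext q
    by_cases h : p q <;> simp [h]
  · funext t
    refine Finset.prod_eq_one fun q _ => ?_
    by_cases h : p q <;> simp [h]

/-! ### The stabilizer generators -/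

/-- The flip of all qubits in row `i` of block `b`. -/
def rowFlip (n : ℕ) (b : Fin 3) (i : Fin m) : State m n :=
  fun q => if q.1 = b ∧ q.2.1 = i then 1 else 0

/-- The first of the two adjacent rows or columns that a generator with index `i` acts on. -/
def lowerIdx {k : ℕ} (i : Fin (k - 1)) : Fin k := ⟨i.val, by omega⟩

/-- The second of the two adjacent rows or columns that a generator with index `i` acts on. -/
def upperIdx {k : ℕ} (i : Fin (k - 1)) : Fin k := ⟨i.val + 1, by omega⟩

lemma lowerIdx_ne_upperIdx {k : ℕ} (i : Fin (k - 1)) : lowerIdx i ≠ upperIdx i := by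
  simp [lowerIdx, upperIdx]

lemma stabilizer_inl (b : Fin 3) (i : Fin m) (j : Fin (n - 1)) :
    stabilizer (b, Sum.inl (i, j)) =
      mono 0 fun t => sgn (t (b, i, lowerIdx j)) * sgn (t (b, i, upperIdx j)) := by
  rw [stabilizer, pauliOp_z_eq_mono]
  congr 1
  funext t
  have : (Finset.univ.filter fun q : Qubit m n =>
      q.1 = b ∧ q.2.1 = i ∧ (q.2.2.val = j.val ∨ q.2.2.val = j.val + 1)) =
      {(b, i, lowerIdx j), (b, i, upperIdx j)} := by
    ext ⟨b', i', j'⟩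
    simp [lowerIdx, upperIdx, Fin.ext_iff]
    tauto
  rw [this, Finset.prod_pair]
  simp [lowerIdx_ne_upperIdx]

lemma stabilizer_inr (b : Fin 3) (i : Fin (m - 1)) :
    stabilizer (n := n) (b, Sum.inr i) =
      mono (rowFlip n b (lowerIdx i) + rowFlip n b (upperIdx i)) fun _ => 1 := by
  rw [stabilizer, pauliOp_x_eq_mono]
  congr 1
  funext q
  simp only [rowFlip, Pi.add_apply, lowerIdx, upperIdx, Fin.ext_iff]
  by_cases h : q.1.val = b.val <;> by_cases h1 : q.2.1.val = i.val <;>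
    by_cases h2 : q.2.1.val = i.val + 1 <;> simp [h, h1, h2]

/-- A monomial operator without flips whose phase is a character commutes with monomial operators
up to sign. -/
lemma mono_zero_mul_mono {χ : State m n → ℂ} (hχ : ∀ s t, χ (s + t) = χ s * χ t)
    (x : State m n) (φ : State m n → ℂ) :
    mono 0 χ * mono x φ = χ x • (mono x φ * mono 0 χ) := by
  rw [mono_mul_mono, mono_mul_mono, smul_mono, zero_add, add_zero]
  congr 1
  funext t
  rw [hχ, add_zero]
  ring

/-- The phase of a `Z`-type generator. -/
def zGenPhase (b : Fin 3) (i : Fin m) (j : Fin (n - 1)) (t : State m n) : ℂ :=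
  sgn (t (b, i, lowerIdx j)) * sgn (t (b, i, upperIdx j))

lemma zGenPhase_add (b : Fin 3) (i : Fin m) (j : Fin (n - 1)) (s t : State m n) :
    zGenPhase b i j (s + t) = zGenPhase b i j s * zGenPhase b i j t := by
  simp only [zGenPhase, Pi.add_apply, sgn_add]
  ring

lemma zGenPhase_rowFlip (b : Fin 3) (i : Fin m) (j : Fin (n - 1)) (b' : Fin 3) (i' : Fin m) :
    zGenPhase b i j (rowFlip n b' i') = 1 := by
  simp only [zGenPhase, rowFlip]
  exact sgn_mul_self _

/-- A row meets each `Z` pair in zero or two qubits. Every single row thus carries a representative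
of the logical `X`. -/
lemma stabilizer_commute_rowFlip (k : Gen m n) (b : Fin 3) (i : Fin m) :
    Commute (stabilizer k) (mono (rowFlip n b i) fun _ => 1) := by
  obtain ⟨b', ⟨i', j'⟩ | i'⟩ := k
  · rw [stabilizer_inl]
    change mono 0 (zGenPhase b' i' j') * _ = _ * mono 0 (zGenPhase b' i' j')
    rw [mono_zero_mul_mono (zGenPhase_add b' i' j'), zGenPhase_rowFlip, one_smul]
  · rw [stabilizer_inr]
    change _ * _ = _ * _
    simp [mono_mul_mono, add_comm]

lemma rowFlip_mul_rowFlip (b b' : Fin 3) (i i' : Fin m) :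
    (mono (rowFlip n b i + rowFlip n b' i') fun _ => (1 : ℂ)) =
      (mono (rowFlip n b i) fun _ => 1) * mono (rowFlip n b' i') fun _ => 1 := by
  simp [mono_mul_mono]

lemma stabilizer_commute (k l : Gen m n) : Commute (stabilizer k) (stabilizer l) := by
  obtain ⟨b', ⟨i', j'⟩ | i'⟩ := l
  · obtain ⟨b, ⟨i, j⟩ | i⟩ := k
    · rw [stabilizer_inl, stabilizer_inl]
      change _ * _ = _ * _
      simp [mono_mul_mono, mul_comm]
    · rw [stabilizer_inr, rowFlip_mul_rowFlip]
      exact ((stabilizer_commute_rowFlip _ _ _).symm).mul_left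
        ((stabilizer_commute_rowFlip _ _ _).symm)
  · rw [stabilizer_inr b', rowFlip_mul_rowFlip]
    exact (stabilizer_commute_rowFlip _ _ _).mul_right (stabilizer_commute_rowFlip _ _ _)

lemma stabilizer_mul_self (k : Gen m n) : stabilizer k * stabilizer k = 1 := by
  obtain ⟨b, ⟨i, j⟩ | i⟩ := k
  · rw [stabilizer_inl, mono_mul_mono, one_eq_mono, add_zero]
    congr 1
    funext t
    rw [add_zero, mul_mul_mul_comm, sgn_mul_self, sgn_mul_self, one_mul]
  · rw [stabilizer_inr, mono_mul_mono, one_eq_mono, bits_add_self]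
    simp

lemma stabilizer_conjTranspose (k : Gen m n) : (stabilizer k).conjTranspose = stabilizer k := by
  obtain ⟨b, ⟨i, j⟩ | i⟩ := k
  · rw [stabilizer_inl, mono_conjTranspose]
    simp
  · rw [stabilizer_inr, mono_conjTranspose]
    simp

/-! ### The syndrome projectors -/

/-- One factor of a syndrome projector. -/
def synFactor (α : Gen m n → Fin 2) (k : Gen m n) : Op m n :=
  (2⁻¹ : ℂ) • ((1 : Op m n) + ((-1 : ℂ) ^ (α k).val) • stabilizer k)

lemma neg_one_pow_eq_sgn (x : Fin 2) : (-1 : ℂ) ^ x.val = sgn x := by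
  fin_cases x <;> simp

lemma syndromeProj_eq (α : Gen m n → Fin 2) :
    syndromeProj α = ((Finset.univ : Finset (Gen m n)).toList.map (synFactor α)).prod := rfl

lemma Commute.synFactor_right {A : Op m n} {k : Gen m n} (h : Commute A (stabilizer k))
    (α : Gen m n → Fin 2) : Commute A (synFactor α k) :=
  ((Commute.one_right A).add_right (h.smul_right _)).smul_right _

lemma Commute.syndromeProj_right {A : Op m n} (h : ∀ k, Commute A (stabilizer k))
    (α : Gen m n → Fin 2) : Commute A (syndromeProj α) := by
  rw [syndromeProj_eq]
  refine Commute.list_prod_right _ _ fun B hB => ?_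
  obtain ⟨k, -, rfl⟩ := List.mem_map.1 hB
  exact Commute.synFactor_right (h k) α

lemma synFactor_commute (α β : Gen m n → Fin 2) (k l : Gen m n) :
    Commute (synFactor α k) (synFactor β l) :=
  Commute.synFactor_right (Commute.synFactor_right (stabilizer_commute l k) α).symm β

lemma synFactor_conjTranspose (α : Gen m n → Fin 2) (k : Gen m n) :
    (synFactor α k).conjTranspose = synFactor α k := by
  simp [synFactor, neg_one_pow_eq_sgn, stabilizer_conjTranspose]

lemma syndromeProj_pairwise (α : Gen m n → Fin 2) (L : List (Gen m n)) :
    (L.map (synFactor α)).Pairwise Commute := by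
  rw [List.pairwise_map]
  exact List.Pairwise.imp (fun _ => synFactor_commute α α _ _)
    (List.pairwise_of_forall fun _ _ => trivial)

lemma syndromeProj_conjTranspose (α : Gen m n → Fin 2) :
    (syndromeProj α).conjTranspose = syndromeProj α := by
  rw [syndromeProj_eq, Matrix.conjTranspose_list_prod, List.map_map]
  have : Matrix.conjTranspose ∘ synFactor α = synFactor α :=
    funext fun k => synFactor_conjTranspose α k
  rw [this]
  exact ((List.reverse_perm _).symm.prod_eq' (syndromeProj_pairwise α _)).symm

lemma stabilizer_mul_synFactor (α : Gen m n → Fin 2) (k : Gen m n) :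
    stabilizer k * synFactor α k = sgn (α k) • synFactor α k := by
  rw [synFactor, neg_one_pow_eq_sgn, mul_smul_comm, mul_add, mul_one, mul_smul_comm,
    stabilizer_mul_self, smul_comm (sgn (α k)), smul_add (sgn (α k)),
    smul_smul (sgn (α k)) (sgn (α k)),
    sgn_mul_self, one_smul, add_comm]

lemma stabilizer_mul_syndromeProj (α : Gen m n → Fin 2) (k : Gen m n) :
    stabilizer k * syndromeProj α = sgn (α k) • syndromeProj α := by
  have hk : k ∈ (Finset.univ : Finset (Gen m n)).toList := by simp
  obtain ⟨L₁, L₂, hL⟩ := List.append_of_mem hk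
  have hp := (hL ▸ List.perm_middle : (Finset.univ : Finset (Gen m n)).toList.Perm _).map
    (synFactor α)
  rw [syndromeProj_eq, hp.prod_eq' (syndromeProj_pairwise α _), List.map_cons, List.prod_cons,
    ← mul_assoc, stabilizer_mul_synFactor, smul_mul_assoc]

lemma syndromeProj_mul_stabilizer (α : Gen m n → Fin 2) (k : Gen m n) :
    syndromeProj α * stabilizer k = sgn (α k) • syndromeProj α := by
  rw [← stabilizer_mul_syndromeProj]
  exact ((Commute.syndromeProj_right (fun l => stabilizer_commute k l) α).eq).symm

lemma stabilizer_mul_codeProj (k : Gen m n) : stabilizer k * codeProj m n = codeProj m n := by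
  rw [codeProj, stabilizer_mul_syndromeProj, sgn_zero, one_smul]

lemma codeProj_mul_stabilizer (k : Gen m n) : codeProj m n * stabilizer k = codeProj m n := by
  rw [codeProj, syndromeProj_mul_stabilizer, sgn_zero, one_smul]

lemma synFactor_update_add (α : Gen m n → Fin 2) (k : Gen m n) :
    synFactor α k + synFactor (Function.update α k (α k + 1)) k = 1 := by
  simp only [synFactor, neg_one_pow_eq_sgn, Function.update_self, sgn_add, sgn_one]
  rw [← smul_add, mul_neg_one, neg_smul, add_add_add_comm, add_neg_cancel, add_zero, ← two_smul ℂ,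
    smul_smul]
  norm_num

/-- The powers of two account for the components of `α` outside `L`, which are summed over without
affecting the product. In the induction, flipping the component `k` pairs each factor with its
complementary projector. -/
lemma sum_prod_synFactor (L : List (Gen m n)) (hL : L.Nodup) :
    (2 : ℂ) ^ L.length • ∑ α, (L.map (synFactor α)).prod =
      (2 : ℂ) ^ Fintype.card (Gen m n) • (1 : Op m n) := by
  induction L with
  | nil => simp [← Nat.cast_smul_eq_nsmul ℂ]
  | cons k L ih =>
    obtain ⟨hk, hL⟩ := List.nodup_cons.1 hL
    rw [← ih hL, List.length_cons, pow_succ, mul_smul]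
    congr 1
    let flip : (Gen m n → Fin 2) → Gen m n → Fin 2 := fun α => Function.update α k (α k + 1)
    have hflip : Function.Involutive flip := by
      intro α
      funext l
      by_cases h : l = k
      · subst h
        simp [flip, add_assoc]
      · simp [flip, h]
    have h1 : ∑ α, ((k :: L).map (synFactor α)).prod =
        ∑ α, ((k :: L).map (synFactor (flip α))).prod :=
      (Equiv.sum_comp hflip.toPerm fun α => ((k :: L).map (synFactor α)).prod).symm
    rw [two_smul]
    nth_rewrite 2 [h1]
    rw [← Finset.sum_add_distrib]
    refine Finset.sum_congr rfl fun α _ => ?_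
    have h2 : L.map (synFactor (flip α)) = L.map (synFactor α) := by
      refine List.map_congr_left fun l hl => ?_
      have : l ≠ k := fun h => hk (h ▸ hl)
      simp [synFactor, flip, this]
    rw [List.map_cons, List.map_cons, List.prod_cons, List.prod_cons, h2, ← add_mul,
      synFactor_update_add, one_mul]

lemma sum_syndromeProj : ∑ α : Gen m n → Fin 2, syndromeProj α = 1 := by
  have h := sum_prod_synFactor (m := m) (n := n) _ (Finset.nodup_toList Finset.univ)
  rw [Finset.length_toList, Finset.card_univ] at h
  exact smul_right_injective _ (pow_ne_zero _ two_ne_zero) h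

lemma codeProj_mulVec {v : State m n → ℂ} (hv : ∀ k, (stabilizer k).mulVec v = v) :
    (codeProj m n).mulVec v = v := by
  have : ∀ L : List (Gen m n), ((L.map (synFactor fun _ => 0)).prod).mulVec v = v := by
    intro L
    induction L with
    | nil => simp
    | cons k L ih =>
      rw [List.map_cons, List.prod_cons, ← Matrix.mulVec_mulVec, ih, synFactor, Matrix.smul_mulVec,
        Matrix.add_mulVec, Matrix.smul_mulVec, hv k, Matrix.one_mulVec]
      simp only [neg_one_pow_eq_sgn, sgn_zero, one_smul]
      rw [← two_smul ℂ, smul_smul]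
      norm_num
  exact this _

/-! ### Logical operators and scalars on the codespace -/

/-- The phase of the logical operator `Z̄` of block `b`. -/
def logicalPhase [NeZero n] (b : Fin 3) (t : State m n) : ℂ := ∏ i, sgn (t (b, i, 0))

lemma logicalZ_eq_mono [NeZero n] (b : Fin 3) : logicalZ m n b = mono 0 (logicalPhase b) := by
  rw [logicalZ, pauliOp_z_eq_mono]
  congr 1
  funext t
  rw [Finset.prod_filter, Fintype.prod_prod_type, Finset.prod_eq_single b]
  · rw [Fintype.prod_prod_type, logicalPhase]
    refine Finset.prod_congr rfl fun i _ => ?_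
    rw [Finset.prod_eq_single 0] <;> simp +contextual
  · intro b' _ hb'
    simp [hb']
  · simp

lemma logicalPhase_add [NeZero n] (b : Fin 3) (s t : State m n) :
    logicalPhase b (s + t) = logicalPhase b s * logicalPhase b t := by
  simp [logicalPhase, sgn_add, Finset.prod_mul_distrib]

lemma logicalPhase_mul_self [NeZero n] (b : Fin 3) (s : State m n) :
    logicalPhase b s * logicalPhase b s = 1 := by
  simp [logicalPhase, ← Finset.prod_mul_distrib, sgn_mul_self]

lemma logicalPhase_rowFlip [NeZero n] (b b' : Fin 3) (i : Fin m) :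
    logicalPhase b (rowFlip n b' i) = if b = b' then -1 else 1 := by
  rw [logicalPhase]
  split_ifs with h
  · rw [Finset.prod_eq_single i] <;> simp +contextual [rowFlip, h]
  · simp [rowFlip, h]

lemma logicalPhase_eq_sgn [NeZero n] (b : Fin 3) (s : State m n) :
    logicalPhase b s = sgn (∑ i, s (b, i, 0)) := (sgn_sum _ _).symm

/-- All qubits in one row have the same bit. -/
def RowConst (s : State m n) : Prop := ∀ b i j j', s (b, i, j) = s (b, i, j')

/-- The generators link only neighbouring rows or columns; this extends the link to arbitrary ones.
-/
lemma eq_of_eq_succ {k : ℕ} {β : Type*} (f : Fin k → β)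
    (h : ∀ j : Fin (k - 1), f (lowerIdx j) = f (upperIdx j)) (j j' : Fin k) : f j = f j' := by
  have key : ∀ (a : ℕ) (ha : a < k), f ⟨a, ha⟩ = f ⟨0, by omega⟩ := by
    intro a
    induction a with
    | zero => intro _; rfl
    | succ a ih =>
      intro ha
      rw [← ih (by omega)]
      exact (h ⟨a, by omega⟩).symm
  exact (key j.1 j.2).trans (key j'.1 j'.2).symm

lemma rowConst_of_zGenPhase {s : State m n} (h : ∀ b i j, zGenPhase b i j s = 1) : RowConst s := by
  intro b i
  refine eq_of_eq_succ _ fun j => ?_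
  have := h b i j
  rw [zGenPhase, ← sgn_add, sgn_eq_one_iff] at this
  rw [← zero_add (s (b, i, upperIdx j)), ← this, add_assoc, bit_add_self, add_zero]

/-- The row bits `a` as a basis state. -/
def ofRows (n : ℕ) (a : Fin 3 → Fin m → Fin 2) : State m n := fun q => a q.1 q.2.1

lemma rowConst_ofRows (a : Fin 3 → Fin m → Fin 2) : RowConst (ofRows n a) :=
  fun _ _ _ _ => rfl

lemma RowConst.eq_ofRows [NeZero n] {s : State m n} (h : RowConst s) :
    s = ofRows n fun b i => s (b, i, 0) :=
  funext fun ⟨b, i, j⟩ => h b i j 0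

/-- The flip of row `i` of block `b` if `x = 1`. -/
def condFlip (n : ℕ) (b : Fin 3) (i : Fin m) (x : Fin 2) : State m n :=
  if x = 0 then 0 else rowFlip n b i

lemma condFlip_add (b : Fin 3) (i : Fin m) (x y : Fin 2) :
    condFlip n b i (x + y) = condFlip n b i x + condFlip n b i y := by
  fin_cases x <;> fin_cases y <;> simp [condFlip, bits_add_self]

lemma condFlip_sum (b : Fin 3) (i : Fin m) (a : Fin m → Fin 2) :
    condFlip n b i (∑ l, a l) = ∑ l, condFlip n b i (a l) :=
  map_sum (AddMonoidHom.mk' (condFlip n b i) (condFlip_add b i)) a Finset.univ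

lemma ofRows_eq_sum (a : Fin 3 → Fin m → Fin 2) :
    ofRows n a = ∑ b, ∑ i, condFlip n b i (a b i) := by
  funext ⟨b, i, j⟩
  simp only [Finset.sum_apply]
  rw [Finset.sum_eq_single b, Finset.sum_eq_single i]
  · obtain h | h : a b i = 0 ∨ a b i = 1 := by omega
    all_goals simp [condFlip, h, ofRows, rowFlip]
  · intro i' _ hi'
    obtain h | h : a b i' = 0 ∨ a b i' = 1 := by omega
    all_goals simp [condFlip, h, rowFlip, hi'.symm]
  · simp
  · intro b' _ hb'
    refine Finset.sum_eq_zero fun i' _ => ?_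
    obtain h | h : a b' i' = 0 ∨ a b' i' = 1 := by omega
    all_goals simp [condFlip, h, rowFlip, hb'.symm]
  · simp

/-- `M` is an operator on the codespace that commutes with `Z̄` and with some representative of
`X̄` of each block. -/
structure CommutesWithLogicals [NeZero n] (M : Op m n) : Prop where
  left : ∀ k, stabilizer k * M = M
  right : ∀ k, M * stabilizer k = M
  z : ∀ b, logicalZ m n b * M = M * logicalZ m n b
  x : ∀ b, ∃ i, (mono (rowFlip n b i) fun _ => 1) * M = M * mono (rowFlip n b i) fun _ => 1

namespace CommutesWithLogicals

variable [NeZero n] {M : Op m n}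

/-- Diagonal operators only rescale entries, so a nonzero entry forces equal eigenvalues on the two
sides. -/
lemma support (hM : CommutesWithLogicals M) {s t : State m n} (h : M s t ≠ 0) :
    RowConst s ∧ RowConst t ∧ ∀ b, logicalPhase b s = logicalPhase b t := by
  refine ⟨rowConst_of_zGenPhase fun b i j => ?_, rowConst_of_zGenPhase fun b i j => ?_, fun b => ?_⟩
  · have := congrFun (congrFun (hM.left (b, Sum.inl (i, j))) s) t
    rw [stabilizer_inl, mono_mul_apply, add_zero] at this
    exact mul_right_cancel₀ h (this.trans (one_mul _).symm)
  · have := congrFun (congrFun (hM.right (b, Sum.inl (i, j))) s) t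
    rw [stabilizer_inl, mul_mono_apply, add_zero] at this
    exact mul_left_cancel₀ h (this.trans (mul_one _).symm)
  · have := congrFun (congrFun (hM.z b) s) t
    rw [logicalZ_eq_mono, mul_mono_apply, mono_mul_apply, add_zero, add_zero, mul_comm] at this
    exact mul_left_cancel₀ h this

/-- The pairs of flips under which the entries of `M` are invariant. -/
def invariance (M : Op m n) : AddSubmonoid (State m n × State m n) where
  carrier := {p | ∀ s t, M (s + p.1) (t + p.2) = M s t}
  zero_mem' := fun s t => by simp
  add_mem' := fun {p q} hp hq s t => by
    rw [Prod.fst_add, Prod.snd_add, ← add_assoc, ← add_assoc, hq, hp]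

lemma mem_invariance_left (hM : CommutesWithLogicals M) (b : Fin 3) (i i' : Fin m) :
    (rowFlip n b i + rowFlip n b i', (0 : State m n)) ∈ invariance M := by
  let f : Fin m → State m n → State m n → ℂ := fun i s t => M (s + rowFlip n b i) t
  have hf : f i = f i' := by
    refine eq_of_eq_succ f (fun j => ?_) i i'
    funext s t
    have := congrFun (congrFun (hM.left (b, Sum.inr j)) (s + rowFlip n b (lowerIdx j))) t
    rw [stabilizer_inr, mono_mul_apply, one_mul, ← add_assoc, bits_add_add_cancel] at this
    exact this.symm
  intro s t
  have := congrFun (congrFun hf (s + rowFlip n b i')) t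
  simp only [f, bits_add_add_cancel] at this
  rw [← this, add_zero, add_comm (rowFlip n b i), add_assoc]

lemma mem_invariance_right (hM : CommutesWithLogicals M) (b : Fin 3) (i i' : Fin m) :
    ((0 : State m n), rowFlip n b i + rowFlip n b i') ∈ invariance M := by
  let f : Fin m → State m n → State m n → ℂ := fun i s t => M s (t + rowFlip n b i)
  have hf : f i = f i' := by
    refine eq_of_eq_succ f (fun j => ?_) i i'
    funext s t
    have := congrFun (congrFun (hM.right (b, Sum.inr j)) s) (t + rowFlip n b (lowerIdx j))
    rw [stabilizer_inr, mul_mono_apply, mul_one, ← add_assoc, bits_add_add_cancel] at this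
    exact this.symm
  intro s t
  have := congrFun (congrFun hf s) (t + rowFlip n b i')
  simp only [f, bits_add_add_cancel] at this
  rw [← this, add_zero, add_comm (rowFlip n b i), add_assoc]

lemma mem_invariance_both (hM : CommutesWithLogicals M) (b : Fin 3) (i : Fin m) :
    (rowFlip n b i, rowFlip n b i) ∈ invariance M := by
  obtain ⟨i', hi'⟩ := hM.x b
  have h1 : (rowFlip n b i', rowFlip n b i') ∈ invariance M := by
    intro s t
    have := congrFun (congrFun hi' s) (t + rowFlip n b i')
    rw [mono_mul_apply, mul_mono_apply, bits_add_add_cancel, one_mul, mul_one] at this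
    exact this
  -- Multiplying by pairs of rows on both sides moves the logical `X` from row `i'` to row `i`.
  have h2 := add_mem (add_mem (hM.mem_invariance_left b i i') (hM.mem_invariance_right b i i')) h1
  simpa [bits_add_add_cancel] using h2

/-- Pairs of rows on the left move all flips of `s` to one row `i₀`, and pairs on the right do so
for `t`. What remains on `i₀` are the two parities; they agree, so a simultaneous flip removes them.
-/
lemma apply_eq (hM : CommutesWithLogicals M) {s t : State m n} (hs : RowConst s) (ht : RowConst t)
    (h : ∀ b, logicalPhase b s = logicalPhase b t) : M s t = M 0 0 := by
  have key : (s, t) ∈ invariance M := by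
    rw [hs.eq_ofRows, ht.eq_ofRows, ofRows_eq_sum, ofRows_eq_sum, prod_mk_sum]
    refine sum_mem fun b _ => ?_
    rcases Nat.eq_zero_or_pos m with hm | hm
    · subst hm
      simp only [Finset.univ_eq_empty, Finset.sum_empty]
      exact (invariance M).zero_mem
    let i₀ : Fin m := ⟨0, hm⟩
    have hb : ∑ i, s (b, i, 0) = ∑ i, t (b, i, 0) := by
      have := h b
      rw [logicalPhase_eq_sgn, logicalPhase_eq_sgn] at this
      exact sgn_injective this
    have h1 : (∑ i, (condFlip n b i (s (b, i, 0)) + condFlip n b i₀ (s (b, i, 0))), 0) ∈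
        invariance M := by
      have : (∑ i, (condFlip n b i (s (b, i, 0)) + condFlip n b i₀ (s (b, i, 0))), (0 : State m n))
          = ∑ i, (condFlip n b i (s (b, i, 0)) + condFlip n b i₀ (s (b, i, 0)), 0) := by
        rw [← prod_mk_sum]; simp
      rw [this]
      refine sum_mem fun i _ => ?_
      obtain h | h : s (b, i, 0) = 0 ∨ s (b, i, 0) = 1 := by omega
      · simp only [condFlip, h, if_true, add_zero]
        exact (invariance M).zero_mem
      · simpa [condFlip, h] using hM.mem_invariance_left b i i₀
    have h2 : (0, ∑ i, (condFlip n b i (t (b, i, 0)) + condFlip n b i₀ (t (b, i, 0)))) ∈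
        invariance M := by
      have : ((0 : State m n), ∑ i, (condFlip n b i (t (b, i, 0)) + condFlip n b i₀ (t (b, i, 0))))
          = ∑ i, (0, condFlip n b i (t (b, i, 0)) + condFlip n b i₀ (t (b, i, 0))) := by
        rw [← prod_mk_sum]; simp
      rw [this]
      refine sum_mem fun i _ => ?_
      obtain h | h : t (b, i, 0) = 0 ∨ t (b, i, 0) = 1 := by omega
      · simp only [condFlip, h, if_true, add_zero]
        exact (invariance M).zero_mem
      · simpa [condFlip, h] using hM.mem_invariance_right b i i₀
    have h3 : (condFlip n b i₀ (∑ i, s (b, i, 0)), condFlip n b i₀ (∑ i, t (b, i, 0))) ∈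
        invariance M := by
      rw [hb]
      obtain h | h : ∑ i, t (b, i, 0) = 0 ∨ ∑ i, t (b, i, 0) = 1 := by omega
      · simp only [condFlip, h, if_true]
        exact (invariance M).zero_mem
      · simpa [condFlip, h] using hM.mem_invariance_both b i₀
    have h4 := add_mem (add_mem h1 h2) h3
    simpa [Finset.sum_add_distrib, ← condFlip_sum, bits_add_add_cancel] using h4
  simpa using key 0 0

end CommutesWithLogicals

lemma codeProj_commute_rowFlip (b : Fin 3) (i : Fin m) :
    Commute (mono (rowFlip n b i) fun _ => 1) (codeProj m n) :=
  Commute.syndromeProj_right (fun k => (stabilizer_commute_rowFlip k b i).symm) _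

lemma logicalZ_commute_stabilizer [NeZero n] (k : Gen m n) (b : Fin 3) :
    Commute (logicalZ m n b) (stabilizer k) := by
  rw [logicalZ_eq_mono]
  obtain ⟨b', ⟨i', j'⟩ | i'⟩ := k
  · rw [stabilizer_inl]
    change _ * _ = _ * _
    simp [mono_mul_mono, mul_comm]
  · rw [stabilizer_inr]
    change _ * _ = _ * _
    rw [mono_zero_mul_mono (logicalPhase_add b), logicalPhase_add]
    rw [logicalPhase_rowFlip, logicalPhase_rowFlip]
    split_ifs <;> simp

lemma commutesWithLogicals_codeProj [NeZero m] [NeZero n] :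
    CommutesWithLogicals (codeProj m n) where
  left := stabilizer_mul_codeProj
  right := codeProj_mul_stabilizer
  z := fun b => Commute.syndromeProj_right
    (fun k => logicalZ_commute_stabilizer k b) _
  x := fun b => ⟨0, codeProj_commute_rowFlip b 0⟩

lemma rowConst_add_iff {s x : State m n} (hx : RowConst x) : RowConst (s + x) ↔ RowConst s := by
  constructor
  · intro h b i j j'
    have := h b i j j'
    rw [Pi.add_apply, Pi.add_apply, hx b i j j'] at this
    exact add_right_cancel this
  · intro h b i j j'
    rw [Pi.add_apply, Pi.add_apply, hx b i j j', h b i j j']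

lemma rowConst_rowFlip (b : Fin 3) (i : Fin m) : RowConst (rowFlip n b i) :=
  fun _ _ _ _ => rfl

open Classical in
/-- Unnormalized code states: a function of the row bits that is invariant under flips of pairs
of rows. -/
lemma stabilizer_mulVec_codeState {w : State m n → ℂ}
    (hw : ∀ b i i' s, w (s + (rowFlip n b i + rowFlip n b i')) = w s) (k : Gen m n) :
    (stabilizer k).mulVec (fun s => if RowConst s then w s else 0) =
      fun s => if RowConst s then w s else 0 := by
  obtain ⟨b, ⟨i, j⟩ | i⟩ := k
  · rw [stabilizer_inl]
    funext s
    rw [mono_mulVec_apply, add_zero]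
    split_ifs with h
    · rw [h b i (lowerIdx j) (upperIdx j), sgn_mul_self, one_mul]
    · rw [mul_zero]
  · rw [stabilizer_inr]
    funext s
    rw [mono_mulVec_apply, one_mul, hw]
    have : RowConst (rowFlip n b (lowerIdx i) + rowFlip n b (upperIdx i)) :=
      (rowConst_add_iff (rowConst_rowFlip _ _)).2 (rowConst_rowFlip _ _)
    simp only [rowConst_add_iff this]

/-- Otherwise `apply_eq` would make the whole projector vanish, yet it fixes the sum of all
row-constant basis states. -/
lemma codeProj_zero_zero_ne_zero [NeZero m] [NeZero n] : codeProj m n 0 0 ≠ 0 := by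
  classical
  intro h0
  have hP : codeProj m n = 0 := by
    ext s t
    by_contra h
    obtain ⟨h1, h2, h3⟩ := commutesWithLogicals_codeProj.support h
    exact h ((commutesWithLogicals_codeProj.apply_eq h1 h2 h3).trans h0)
  have h1 := congrFun (codeProj_mulVec (m := m) (n := n)
    (stabilizer_mulVec_codeState (w := fun _ => 1) fun _ _ _ _ => rfl)) 0
  rw [hP, Matrix.zero_mulVec, if_pos (show RowConst (0 : State m n) from fun _ _ _ _ => rfl)] at h1
  simp at h1

/-- Schur's lemma for the codespace. -/
lemma CommutesWithLogicals.eq_smul_codeProj [NeZero m] [NeZero n] {M : Op m n}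
    (hM : CommutesWithLogicals M) : M = (M 0 0 / codeProj m n 0 0) • codeProj m n := by
  have hP := commutesWithLogicals_codeProj (m := m) (n := n)
  ext s t
  rw [Matrix.smul_apply, smul_eq_mul]
  by_cases h : RowConst s ∧ RowConst t ∧ ∀ b, logicalPhase b s = logicalPhase b t
  · rw [hM.apply_eq h.1 h.2.1 h.2.2, hP.apply_eq h.1 h.2.1 h.2.2,
      div_mul_cancel₀ _ codeProj_zero_zero_ne_zero]
  · rw [of_not_not fun h' => h (hM.support h'), of_not_not fun h' => h (hP.support h'), mul_zero]

/-! ### Faulty circuits as monomial operators -/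

/-- The rightmost factor acts first, so factor `k` sees the flips of the factors with larger index.
-/
lemma prod_ofFn_mono {N : ℕ} (x : Fin N → State m n) (φ : Fin N → State m n → ℂ) :
    (List.ofFn fun k => mono (x k) (φ k)).prod =
      mono (∑ k, x k) fun t => ∏ k, φ k (t + ∑ k', if k < k' then x k' else 0) := by
  induction N with
  | zero => simp [one_eq_mono]
  | succ N ih =>
    rw [List.ofFn_succ, List.prod_cons, ih, mono_mul_mono, Fin.sum_univ_succ]
    congr 1
    funext t
    rw [Fin.prod_univ_succ]
    congr 1
    · simp [Fin.sum_univ_succ]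
    · refine Finset.prod_congr rfl fun k _ => ?_
      simp [Fin.sum_univ_succ]

/-- The flips made by the Pauli error `e` on the qubits of the gate `g`. -/
def gateFlip (g : CCZGate m n) (e : Fin 3 → Fin 4) : State m n :=
  fun q => if g q.1 = q.2 then xbit (e q.1) else 0

/-- The phase of the Pauli error `e` on the qubits of the gate `g`. -/
def gatePhase (g : CCZGate m n) (e : Fin 3 → Fin 4) (t : State m n) : ℂ :=
  ∏ b, pphase (e b) (t (b, g b))

/-- The phase of a CCZ gate. -/
def cczPhase (g : CCZGate m n) (t : State m n) : ℂ :=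
  sgn (t (0, g 0) * t (1, g 1) * t (2, g 2))

lemma gatePauli_eq_mono (g : CCZGate m n) (e : Fin 3 → Fin 4) :
    gatePauli g e = mono (gateFlip g e) (gatePhase g e) := by
  rw [gatePauli, pauliOp_eq_mono]
  congr 1
  · funext q
    by_cases h : g q.1 = q.2 <;> simp [gateFlip, h]
  · funext t
    rw [Fintype.prod_prod_type, gatePhase]
    refine Finset.prod_congr rfl fun b _ => ?_
    rw [Finset.prod_eq_single (g b)]
    · simp
    · intro r _ hr
      rw [if_neg hr.symm, pphase_zero]
    · simp

lemma cczOp_eq_mono (g : CCZGate m n) : cczOp g = mono 0 (cczPhase g) := by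
  rw [cczOp, diagonal_eq_mono]
  congr 1
  funext t
  rw [cczPhase]
  simp only [Fin.forall_fin_succ, IsEmpty.forall_iff, and_true, Fin.succ_zero_eq_one,
    Fin.succ_one_eq_two]
  generalize t (0, g 0) = x
  generalize t (1, g 1) = y
  generalize t (2, g 2) = z
  fin_cases x <;> fin_cases y <;> fin_cases z <;> simp

namespace CCZCircuit

variable (C : CCZCircuit m n)

variable {C} in
/-- The gate at a location. -/
def Loc.gate (l : C.Loc) : CCZGate m n := l.2.1

/-- All locations, the latest ones first. -/
def locList : List C.Loc :=
  (List.ofFn fun t : Fin C.depth =>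
    (Finset.univ : Finset {g : CCZGate m n // g ∈ C.step t}).toList.map fun g =>
      (⟨t, g⟩ : C.Loc)).reverse.flatten

lemma mem_locList (l : C.Loc) : l ∈ C.locList := by
  rw [locList, List.mem_flatten]
  refine ⟨_, List.mem_reverse.2 (List.mem_ofFn.2 ⟨l.1, rfl⟩), ?_⟩
  simp

lemma nodup_locList : C.locList.Nodup := by
  rw [locList, List.nodup_flatten]
  constructor
  · intro L hL
    obtain ⟨t, rfl⟩ := List.mem_ofFn.1 (List.mem_reverse.1 hL)
    exact (Finset.nodup_toList _).map fun a b h => by simpa using h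
  · rw [List.pairwise_reverse, List.pairwise_ofFn]
    intro t t' h l hl hl'
    simp only [List.mem_map] at hl hl'
    obtain ⟨g, -, rfl⟩ := hl
    obtain ⟨g', -, h'⟩ := hl'
    exact h.ne (congrArg Sigma.fst h')

open Classical in
/-- The position of a location in the circuit, counted from the end. -/
def pos : C.Loc ≃ Fin C.locList.length :=
  (C.nodup_locList.getEquivOfForallMemList C.locList C.mem_locList).symm

variable {C}

/-- The flips of all errors that occur before the gate at `l`. -/
def flipsBefore (f : C.FaultPattern) (l : C.Loc) : State m n :=
  ∑ l' : C.Loc, if C.pos l < C.pos l' then gateFlip l'.gate (f l') else 0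

/-- The flips of all errors. -/
def flips (f : C.FaultPattern) : State m n := ∑ l : C.Loc, gateFlip l.gate (f l)

lemma faultyOp_eq_prod_locList (f : C.FaultPattern) :
    C.faultyOp f = (C.locList.map fun l => gatePauli l.gate (f l) * cczOp l.gate).prod := by
  rw [faultyOp, locList, List.map_flatten, List.prod_flatten, List.map_reverse, List.map_reverse,
    List.map_ofFn, List.map_ofFn]
  congr 3
  funext t
  simp [Function.comp_def, Loc.gate]

lemma faultyOp_eq_mono (f : C.FaultPattern) :
    C.faultyOp f = mono (flips f) fun t => ∏ l : C.Loc,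
      gatePhase l.gate (f l) (t + flipsBefore f l) * cczPhase l.gate (t + flipsBefore f l) := by
  have h : C.locList.map (fun l => gatePauli l.gate (f l) * cczOp l.gate) =
      List.ofFn fun k => mono (gateFlip (C.pos.symm k).gate (f (C.pos.symm k))) fun t =>
        gatePhase (C.pos.symm k).gate (f (C.pos.symm k)) t *
          cczPhase (C.pos.symm k).gate t := by
    conv_lhs => rw [← List.ofFn_get C.locList, List.map_ofFn]
    congr 1
    funext k
    simp only [Function.comp_def, gatePauli_eq_mono, cczOp_eq_mono, mono_mul_mono, add_zero]
    rfl
  rw [faultyOp_eq_prod_locList, h, prod_ofFn_mono]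
  congr 1
  · exact C.pos.symm.sum_comp fun l => gateFlip l.gate (f l)
  · funext t
    rw [← C.pos.symm.prod_comp]
    refine Finset.prod_congr rfl fun k _ => ?_
    have : flipsBefore f (C.pos.symm k) = ∑ k', if k < k' then
        gateFlip (C.pos.symm k').gate (f (C.pos.symm k')) else 0 := by
      rw [flipsBefore, ← C.pos.symm.sum_comp]
      simp
    rw [this]

@[simp] lemma gateFlip_zero (g : CCZGate m n) : gateFlip g 0 = 0 := by
  funext q
  simp [gateFlip]

@[simp] lemma gatePhase_zero (g : CCZGate m n) (t : State m n) : gatePhase g 0 t = 1 := by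
  simp [gatePhase]

lemma idealOp_eq_mono : C.idealOp = mono 0 fun t => ∏ l : C.Loc, cczPhase l.gate t := by
  rw [idealOp, faultyOp_eq_mono]
  simp [flips, flipsBefore]

/-- The phase of the faulty circuit relative to the ideal circuit. -/
def relPhase (f : C.FaultPattern) (t : State m n) : ℂ :=
  ∏ l : C.Loc, gatePhase l.gate (f l) (t + flipsBefore f l) *
    (cczPhase l.gate (t + flipsBefore f l) * cczPhase l.gate t)

lemma faultyOp_mul_idealOp (f : C.FaultPattern) :
    C.faultyOp f * C.idealOp.conjTranspose = mono (flips f) (relPhase f) := by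
  rw [faultyOp_eq_mono, idealOp_eq_mono, mono_conjTranspose, mono_mul_mono, add_zero]
  congr 1
  funext t
  rw [add_zero, relPhase, star_prod, ← Finset.prod_mul_distrib]
  refine Finset.prod_congr rfl fun l _ => ?_
  rw [mul_assoc]
  congr 2
  exact star_sgn _

lemma kraus_eq (ε : ℝ) (f : C.FaultPattern) :
    C.kraus ε f = ((C.amplitude (ε ^ 2) f : ℝ) : ℂ) • mono (flips f) (relPhase f) := by
  rw [kraus, faultyOp_mul_idealOp]

/-- The number of failing gates. -/
def weight (f : C.FaultPattern) : ℕ := (Finset.univ.filter fun l => f l ≠ 0).card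

end CCZCircuit

namespace CCZCircuit

variable {C : CCZCircuit m n}

/-! ### Orders in the error parameter -/

/-- The ratio of `amplitude (ε ^ 2) f` and `ε ^ weight f`. -/
def amplitudeFactor (f : C.FaultPattern) (ε : ℝ) : ℝ :=
  ∏ l, if f l = 0 then Real.sqrt (1 - ε ^ 2) else Real.sqrt (1 / 63)

lemma amplitude_eq (f : C.FaultPattern) {ε : ℝ} (hε : 0 ≤ ε) :
    C.amplitude (ε ^ 2) f = ε ^ weight f * amplitudeFactor f ε := by
  have h : ε ^ weight f = ∏ l, if f l = 0 then 1 else ε := by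
    rw [Finset.prod_ite, Finset.prod_const_one, one_mul, Finset.prod_const, weight]
  rw [h, amplitude, amplitudeFactor, ← Finset.prod_mul_distrib]
  refine Finset.prod_congr rfl fun l _ => ?_
  split_ifs
  · rw [one_mul]
  · rw [div_eq_mul_one_div, Real.sqrt_mul (sq_nonneg ε), Real.sqrt_sq hε]

lemma amplitudeFactor_tendsto (f : C.FaultPattern) :
    ∃ g : ℝ, g ≠ 0 ∧ Tendsto (amplitudeFactor f) (𝓝[>] 0) (𝓝 g) := by
  refine ⟨amplitudeFactor f 0, ?_, ?_⟩
  · refine Finset.prod_ne_zero_iff.2 fun l _ => ?_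
    split_ifs <;> simp
  · have : Continuous (amplitudeFactor f) := by
      refine continuous_finsetProd _ fun l _ => ?_
      split_ifs <;> fun_prop
    exact this.continuousAt.tendsto.mono_left nhdsWithin_le_nhds

lemma amplitudeFactor_nonneg (f : C.FaultPattern) (ε : ℝ) : 0 ≤ amplitudeFactor f ε := by
  refine Finset.prod_nonneg fun l _ => ?_
  split_ifs <;> positivity

lemma amplitudeFactor_le_one (f : C.FaultPattern) (ε : ℝ) : amplitudeFactor f ε ≤ 1 := by
  refine Finset.prod_le_one (fun l _ => ?_) fun l _ => ?_
  · split_ifs <;> positivity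
  · split_ifs
    · exact Real.sqrt_le_one.2 (by nlinarith [sq_nonneg ε])
    · exact Real.sqrt_le_one.2 (by norm_num)

/-- The matrix of the error-correction conditions, without the amplitudes. -/
def core (i j : C.FaultPattern) (α : Gen m n → Fin 2) : Op m n :=
  codeProj m n * (mono (flips i) (relPhase i)).conjTranspose * syndromeProj α *
    mono (flips j) (relPhase j) * codeProj m n

lemma kraus_core (ε : ℝ) (i j : C.FaultPattern) (α : Gen m n → Fin 2) :
    codeProj m n * (C.kraus ε i).conjTranspose * syndromeProj α * C.kraus ε j * codeProj m n =
      ((C.amplitude (ε ^ 2) i * C.amplitude (ε ^ 2) j : ℝ) : ℂ) • core i j α := by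
  rw [kraus_eq, kraus_eq, Matrix.conjTranspose_smul, core]
  simp only [Matrix.mul_smul, Matrix.smul_mul, smul_smul, Complex.star_def, Complex.conj_ofReal,
    Complex.ofReal_mul]
  rw [mul_comm]

lemma core_conjTranspose (i j : C.FaultPattern) (α : Gen m n → Fin 2) :
    (core i j α).conjTranspose = core j i α := by
  have hP : (codeProj m n).conjTranspose = codeProj m n := syndromeProj_conjTranspose _
  simp only [core, Matrix.conjTranspose_mul, hP, syndromeProj_conjTranspose,
    Matrix.conjTranspose_conjTranspose, mul_assoc]

lemma star_codeProj_zero_zero : star (codeProj m n 0 0) = codeProj m n 0 0 :=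
  congrFun (congrFun (syndromeProj_conjTranspose (m := m) (n := n) fun _ => 0) 0) 0

/-- Pairs of total weight at least `d` are already of order `ε ^ d`, so their entry of `γ` may be
zero. For the others Schur's lemma provides the exact scalar. -/
theorem hasEffectiveDistanceSPR_of_core [NeZero m] [NeZero n] {d : ℕ}
    (h : ∀ i j : C.FaultPattern, weight i + weight j < d → ∀ α,
      CommutesWithLogicals (core i j α)) :
    C.HasEffectiveDistanceSPR d := by
  refine ⟨fun α ε => Matrix.of fun i j =>
    ((C.amplitude (ε ^ 2) i * C.amplitude (ε ^ 2) j : ℝ) : ℂ) *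
      if weight i + weight j < d then core i j α 0 0 / codeProj m n 0 0 else 0, ?_, ?_⟩
  · intro α ε
    refine Matrix.IsHermitian.ext fun i j => ?_
    have hc : star (if weight j + weight i < d then core j i α 0 0 / codeProj m n 0 0 else 0) =
        if weight i + weight j < d then core i j α 0 0 / codeProj m n 0 0 else 0 := by
      rw [add_comm (weight j)]
      split_ifs
      · rw [star_div₀, star_codeProj_zero_zero, ← core_conjTranspose j i α,
          Matrix.conjTranspose_apply]
      · exact star_zero _
    simp only [Matrix.of_apply]
    rw [star_mul', hc, mul_comm (C.amplitude (ε ^ 2) j)]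
    congr 1
    exact Complex.conj_ofReal _
  · intro α i j s t
    simp only [kraus_core, Matrix.of_apply]
    by_cases hd : weight i + weight j < d
    · have := (h i j hd α).eq_smul_codeProj
      simp only [if_pos hd]
      have h0 : ∀ c : ℂ, c • core i j α -
          (c * (core i j α 0 0 / codeProj m n 0 0)) • codeProj m n = 0 := by
        intro c
        rw [mul_smul, ← this, sub_self]
      simp only [h0, Matrix.zero_apply]
      exact isBigO_zero _ _
    · simp only [if_neg hd, mul_zero, zero_smul, sub_zero, Matrix.smul_apply, smul_eq_mul]
      refine IsBigO.of_bound ‖core i j α s t‖ ?_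
      filter_upwards [Ioo_mem_nhdsGT (show (0 : ℝ) < 1 by norm_num)] with ε hε
      rw [norm_mul, mul_comm, Complex.norm_real]
      refine mul_le_mul_of_nonneg_left ?_ (norm_nonneg _)
      rw [amplitude_eq i hε.1.le, amplitude_eq j hε.1.le, mul_mul_mul_comm, ← pow_add]
      have h1 : 0 ≤ ε ^ (weight i + weight j) := pow_nonneg hε.1.le _
      have h2 := mul_nonneg (amplitudeFactor_nonneg i ε) (amplitudeFactor_nonneg j ε)
      rw [Real.norm_of_nonneg (mul_nonneg h1 h2), Real.norm_of_nonneg (pow_nonneg hε.1.le _)]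
      calc ε ^ (weight i + weight j) * (amplitudeFactor i ε * amplitudeFactor j ε)
          ≤ ε ^ (weight i + weight j) * 1 := by
            refine mul_le_mul_of_nonneg_left ?_ h1
            exact mul_le_one₀ (amplitudeFactor_le_one i ε) (amplitudeFactor_nonneg j ε)
              (amplitudeFactor_le_one j ε)
        _ ≤ ε ^ d := by
            rw [mul_one]
            exact pow_le_pow_of_le_one hε.1.le hε.2.le (not_lt.1 hd)

/-- After division by `ε ^ k` the function tends to `g₀ * c`, but also to zero because `k < d`. -/
lemma eq_zero_of_isBigO_pow {c : ℂ} {g : ℝ → ℝ} {g₀ : ℝ} (hg₀ : g₀ ≠ 0)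
    (hg : Tendsto g (𝓝[>] 0) (𝓝 g₀)) {k d : ℕ} (hkd : k < d)
    (h : (fun ε : ℝ => ((ε ^ k * g ε : ℝ) : ℂ) * c) =O[𝓝[>] (0 : ℝ)] fun ε : ℝ => ε ^ d) :
    c = 0 := by
  have h1 : (fun ε : ℝ => ε ^ d) =o[𝓝[>] (0 : ℝ)] fun ε : ℝ => ε ^ k :=
    (isLittleO_pow_pow hkd).mono nhdsWithin_le_nhds
  have h2 := (h.trans_isLittleO h1).tendsto_inv_smul_nhds_zero
  have h3 : Tendsto (fun ε : ℝ => ((g ε : ℝ) : ℂ) * c) (𝓝[>] 0) (𝓝 ((g₀ : ℂ) * c)) :=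
    ((Complex.continuous_ofReal.tendsto g₀).comp hg).mul_const c
  have h4 : (fun ε : ℝ => ((g ε : ℝ) : ℂ) * c) =ᶠ[𝓝[>] 0]
      fun ε => (ε ^ k)⁻¹ • (((ε ^ k * g ε : ℝ) : ℂ) * c) := by
    filter_upwards [self_mem_nhdsWithin] with ε hε
    have hε' : ((ε : ℝ) : ℂ) ≠ 0 := Complex.ofReal_ne_zero.2 (ne_of_gt hε)
    rw [Complex.real_smul]
    push_cast
    field_simp
  have h5 := tendsto_nhds_unique (h3.congr' h4) h2
  exact (mul_eq_zero.1 h5).resolve_left (Complex.ofReal_ne_zero.2 hg₀)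

/-- Code states that are orthogonal stay orthogonal under correctable errors. -/
theorem HasEffectiveDistanceSPR.orthogonal {d : ℕ} (h : C.HasEffectiveDistanceSPR d)
    {i j : C.FaultPattern} (hw : weight i + weight j < d) {u v : State m n → ℂ}
    (hu : (codeProj m n).mulVec u = u) (hv : (codeProj m n).mulVec v = v)
    (huv : dotProduct (star u) v = 0) :
    dotProduct (star u) (((mono (flips i) (relPhase i)).conjTranspose *
      mono (flips j) (relPhase j)).mulVec v) = 0 := by
  obtain ⟨γ, -, hγ⟩ := h
  have hu' : Matrix.vecMul (star u) (codeProj m n) = star u := by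
    have := Matrix.star_mulVec (codeProj m n) u
    rw [hu, codeProj, syndromeProj_conjTranspose] at this
    exact this.symm
  have key : ∀ M : Op m n, dotProduct (star u) ((codeProj m n * M * codeProj m n).mulVec v) =
      dotProduct (star u) (M.mulVec v) := by
    intro M
    rw [← Matrix.mulVec_mulVec, hv, ← Matrix.mulVec_mulVec, Matrix.dotProduct_mulVec, hu']
  obtain ⟨gi, hgi0, hgi⟩ := amplitudeFactor_tendsto i
  obtain ⟨gj, hgj0, hgj⟩ := amplitudeFactor_tendsto j
  have h1 : ∀ α, dotProduct (star u) ((core i j α).mulVec v) = 0 := by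
    intro α
    refine eq_zero_of_isBigO_pow (mul_ne_zero hgi0 hgj0) (hgi.mul hgj) hw ?_
    have h2 : (fun ε : ℝ => ∑ s, ∑ t, star (u s) * ((codeProj m n * (C.kraus ε i).conjTranspose *
        syndromeProj α * C.kraus ε j * codeProj m n - γ α ε i j • codeProj m n) s t * v t))
        =O[𝓝[>] (0 : ℝ)] fun ε : ℝ => ε ^ d := by
      refine IsBigO.fun_sum fun s _ => IsBigO.fun_sum fun t _ => ?_
      have h3 := ((hγ α i j s t).const_mul_left (v t)).const_mul_left (star (u s))
      simpa only [mul_comm (v t)] using h3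
    refine h2.congr' ?_ EventuallyEq.rfl
    filter_upwards [self_mem_nhdsWithin] with ε hε
    have h3 : ∀ M : Op m n, ∑ s, ∑ t, star (u s) * (M s t * v t) =
        dotProduct (star u) (M.mulVec v) := by
      intro M
      simp [dotProduct, Matrix.mulVec, Finset.mul_sum]
    -- The unknown `γ` drops out: `v` is a code state orthogonal to `u`.
    rw [h3, Matrix.sub_mulVec, dotProduct_sub, Matrix.smul_mulVec, hv, dotProduct_smul, huv,
      smul_zero, sub_zero, kraus_core, Matrix.smul_mulVec, dotProduct_smul, smul_eq_mul,
      amplitude_eq i (le_of_lt hε), amplitude_eq j (le_of_lt hε), mul_mul_mul_comm, ← pow_add]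
  -- Summing over all syndromes removes the projector in the middle.
  have h4 : (mono (flips i) (relPhase i)).conjTranspose * mono (flips j) (relPhase j) =
      ∑ α, (mono (flips i) (relPhase i)).conjTranspose * syndromeProj α *
        mono (flips j) (relPhase j) := by
    rw [← Finset.sum_mul, ← Finset.mul_sum, sum_syndromeProj, mul_one]
  rw [h4, Matrix.sum_mulVec, dotProduct_sum]
  refine Finset.sum_eq_zero fun α _ => ?_
  rw [← key, ← h1 α, core]
  simp only [mul_assoc]

end CCZCircuit

namespace CCZCircuit

variable {C : CCZCircuit m n}

/-! ### Sufficient conditions for the error-correction conditions -/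

lemma zGenPhase_mul_self (b : Fin 3) (i : Fin m) (j : Fin (n - 1)) (t : State m n) :
    zGenPhase b i j t * zGenPhase b i j t = 1 := by
  rw [zGenPhase, mul_mul_mul_comm, sgn_mul_self, sgn_mul_self, one_mul]

/-- A `Z` generator is moved from the code projector on the right through the error, which costs the
sign of the flips, into the syndrome projector, which returns the sign of `α`. -/
lemma core_eq_smul (i j : C.FaultPattern) (α : Gen m n → Fin 2) (b : Fin 3) (r : Fin m)
    (c : Fin (n - 1)) :
    core i j α = (zGenPhase b r c (flips j) * sgn (α (b, Sum.inl (r, c)))) • core i j α := by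
  have h1 : mono (flips j) (relPhase j) * stabilizer (b, Sum.inl (r, c)) =
      zGenPhase b r c (flips j) • (stabilizer (b, Sum.inl (r, c)) *
        mono (flips j) (relPhase j)) := by
    rw [stabilizer_inl]
    change _ * mono 0 (zGenPhase b r c) = _ • (mono 0 (zGenPhase b r c) * _)
    rw [mono_zero_mul_mono (zGenPhase_add b r c), smul_smul, zGenPhase_mul_self, one_smul]
  conv_lhs => rw [core, ← stabilizer_mul_codeProj (b, Sum.inl (r, c)), ← mul_assoc,
    mul_assoc _ (mono _ _) (stabilizer _), h1, mul_smul_comm, ← mul_assoc,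
    mul_assoc _ (syndromeProj α) (stabilizer _), syndromeProj_mul_stabilizer, mul_smul_comm]
  rw [smul_mul_assoc, smul_mul_assoc, smul_mul_assoc, smul_smul, stabilizer_mul_codeProj, core]

/-- By `core_eq_smul` and its adjoint, a nonzero matrix requires both errors to have the `Z`
syndrome `α`, so their flips differ by whole rows. -/
lemma core_eq_zero {i j : C.FaultPattern} (h : ¬ RowConst (flips i + flips j))
    (α : Gen m n → Fin 2) : core i j α = 0 := by
  by_contra h0
  obtain ⟨s, t, hst⟩ : ∃ s t, core i j α s t ≠ 0 := by
    by_contra! h'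
    exact h0 (Matrix.ext h')
  refine h (rowConst_of_zGenPhase fun b r c => ?_)
  have h1 := congrFun (congrFun (core_eq_smul i j α b r c) s) t
  have h2 := congrFun (congrFun (core_eq_smul j i α b r c) t) s
  have h3 : core j i α t s ≠ 0 := by
    rw [← core_conjTranspose i j, Matrix.conjTranspose_apply]
    exact star_ne_zero.2 hst
  rw [Matrix.smul_apply, smul_eq_mul] at h1 h2
  have h4 := mul_right_cancel₀ hst ((one_mul _).trans h1)
  have h5 := mul_right_cancel₀ h3 ((one_mul _).trans h2)
  rw [zGenPhase_add]
  have h6 := congrArg₂ (· * ·) h4 h5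
  simp only [one_mul] at h6
  rw [mul_mul_mul_comm, sgn_mul_self, mul_one, mul_comm] at h6
  exact h6.symm

lemma commutesWithLogicals_zero [NeZero m] [NeZero n] :
    CommutesWithLogicals (0 : Op m n) where
  left := fun _ => mul_zero _
  right := fun _ => zero_mul _
  z := fun _ => by rw [mul_zero, zero_mul]
  x := fun _ => ⟨0, by rw [mul_zero, zero_mul]⟩

lemma logicalZ_mul_mono [NeZero n] (b : Fin 3) (x : State m n) (φ : State m n → ℂ) :
    logicalZ m n b * mono x φ = logicalPhase b x • (mono x φ * logicalZ m n b) := by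
  rw [logicalZ_eq_mono, mono_zero_mul_mono (logicalPhase_add b)]

lemma commute_mono_of_invariant {r x : State m n} {φ : State m n → ℂ}
    (h : ∀ t, φ (t + r) = φ t) : Commute (mono r fun _ => 1) (mono x φ) := by
  change _ * _ = _ * _
  rw [mono_mul_mono, mono_mul_mono, add_comm r x]
  simp [h]

/-- Logical `Z` passes two errors with the same flips, so its sign occurs twice and cancels. Logical
`X` is taken on a row on which neither phase depends. -/
lemma commutesWithLogicals_core [NeZero n] {i j : C.FaultPattern} (h : flips i = flips j)
    (hr : ∀ b, ∃ r, (∀ t, relPhase i (t + rowFlip n b r) = relPhase i t) ∧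
      ∀ t, relPhase j (t + rowFlip n b r) = relPhase j t)
    (α : Gen m n → Fin 2) : CommutesWithLogicals (core i j α) where
  left := fun k => by simp only [core, ← mul_assoc, stabilizer_mul_codeProj]
  right := fun k => by rw [core, mul_assoc, codeProj_mul_stabilizer]
  z := fun b => by
    have hα : ∀ β : Gen m n → Fin 2, logicalZ m n b * syndromeProj β =
        syndromeProj β * logicalZ m n b := fun β => Commute.syndromeProj_right
      (fun k => logicalZ_commute_stabilizer k b) β
    have hP : logicalZ m n b * codeProj m n = codeProj m n * logicalZ m n b := hα _
    rw [core, mono_conjTranspose]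
    simp only [← mul_assoc]
    rw [hP, mul_assoc (codeProj m n) (logicalZ m n b), logicalZ_mul_mono, mul_smul_comm,
      ← mul_assoc, smul_mul_assoc, mul_assoc _ (logicalZ m n b) (syndromeProj α), hα, ← mul_assoc,
      smul_mul_assoc, mul_assoc _ (logicalZ m n b) (mono _ _), logicalZ_mul_mono, mul_smul_comm,
      smul_smul, h, logicalPhase_mul_self, one_smul, ← mul_assoc,
      mul_assoc _ (logicalZ m n b) (codeProj m n), hP, mul_assoc _ (codeProj m n)]
  x := fun b => by
    obtain ⟨r, hi, hj⟩ := hr b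
    have hP := codeProj_commute_rowFlip (n := n) b r
    have hα : Commute (mono (rowFlip n b r) fun _ => 1) (syndromeProj α) :=
      Commute.syndromeProj_right (fun k => (stabilizer_commute_rowFlip k b r).symm) _
    refine ⟨r, ?_⟩
    rw [core, mono_conjTranspose]
    refine ((((hP.mul_right (commute_mono_of_invariant fun t => ?_)).mul_right hα).mul_right
      (commute_mono_of_invariant hj)).mul_right hP).eq
    rw [add_right_comm, hi]

/-- No error of `f` spreads to the row `r` of block `b`. -/
def Unaffected (f : C.FaultPattern) (b : Fin 3) (r : Fin m) : Prop :=
  ∀ l : C.Loc, (l.gate b).1 = r → f l = 0 ∧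
    ∀ (l' : C.Loc) (b' : Fin 3), b' ≠ b → l'.gate b' = l.gate b' → xbit (f l' b') = 0

/-- The phase could depend on row `r` only through a gate on that row, either by its own Pauli error
or by flips of its qubits in the other blocks. A flip of the row-`r` qubit itself only produces a
phase in the other two blocks. -/
lemma relPhase_add_rowFlip {f : C.FaultPattern} {b : Fin 3} {r : Fin m} (h : Unaffected f b r)
    (t : State m n) : relPhase f (t + rowFlip n b r) = relPhase f t := by
  refine Finset.prod_congr rfl fun l _ => ?_
  rw [add_right_comm t]
  generalize hX : flipsBefore f l = X
  by_cases hl : (l.gate b).1 = r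
  · obtain ⟨h1, h2⟩ := h l hl
    have hX0 : ∀ b', b' ≠ b → X (b', l.gate b') = 0 := by
      intro b' hb'
      rw [← hX, flipsBefore, Finset.sum_apply]
      refine Finset.sum_eq_zero fun l' _ => ?_
      split_ifs
      · rw [gateFlip]
        split_ifs with h3
        · exact h2 l' b' hb' h3
        · rfl
      · rfl
    have hR0 : ∀ b', b' ≠ b → rowFlip n b r (b', l.gate b') = 0 := by
      intro b' hb'
      simp [rowFlip, hb']
    have hR1 : rowFlip n b r (b, l.gate b) = 1 := by simp [rowFlip, hl]
    rw [h1, gatePhase_zero, gatePhase_zero, one_mul, one_mul, cczPhase, cczPhase, cczPhase,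
      cczPhase, ← sgn_add, ← sgn_add]
    simp only [Pi.add_apply]
    congr 1
    obtain rfl | rfl | rfl : b = 0 ∨ b = 1 ∨ b = 2 := by omega
    · rw [hR1, hX0 1 (by decide), hX0 2 (by decide), hR0 1 (by decide), hR0 2 (by decide)]
      -- Here `w` is the accumulated flip of the qubit in block `b`; the added row flip cancels
      -- between the faulty and the ideal gate.
      have h3 : ∀ x y z w : Fin 2,
        (x + w + 1) * (y + 0 + 0) * (z + 0 + 0) + (x + 1) * (y + 0) * (z + 0) =
        (x + w) * (y + 0) * (z + 0) + x * y * z := by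
        decide
      exact h3 _ _ _ _
    · rw [hR1, hX0 0 (by decide), hX0 2 (by decide), hR0 0 (by decide), hR0 2 (by decide)]
      have h3 : ∀ x y z w : Fin 2,
        (x + 0 + 0) * (y + w + 1) * (z + 0 + 0) + (x + 0) * (y + 1) * (z + 0) =
        (x + 0) * (y + w) * (z + 0) + x * y * z := by
        decide
      exact h3 _ _ _ _
    · rw [hR1, hX0 0 (by decide), hX0 1 (by decide), hR0 0 (by decide), hR0 1 (by decide)]
      have h3 : ∀ x y z w : Fin 2,
        (x + 0 + 0) * (y + 0 + 0) * (z + w + 1) + (x + 0) * (y + 0) * (z + 1) =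
        (x + 0) * (y + 0) * (z + w) + x * y * z := by
        decide
      exact h3 _ _ _ _
  · have hR : ∀ b', rowFlip n b r (b', l.gate b') = 0 := by
      intro b'
      by_cases hb : b' = b
      · subst hb
        simp [rowFlip, hl]
      · simp [rowFlip, hb]
    simp [gatePhase, cczPhase, hR]

lemma exists_of_flips_ne_zero {f : C.FaultPattern} {q : Qubit m n} (h : flips f q ≠ 0) :
    ∃ l : C.Loc, f l ≠ 0 ∧ l.gate q.1 = q.2 := by
  rw [flips, Finset.sum_apply] at h
  obtain ⟨l, -, hl⟩ := Finset.exists_ne_zero_of_sum_ne_zero h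
  refine ⟨l, fun h0 => hl (by simp [h0]), ?_⟩
  by_contra h1
  exact hl (by simp [gateFlip, h1])

/-- Differing flips would differ along a whole row. Each of its `n` columns then needs a failing
gate, and a gate touches only one column per block. -/
lemma flips_eq_of_rowConst {i j : C.FaultPattern} (h : RowConst (flips i + flips j))
    (hw : weight i + weight j < n) : flips i = flips j := by
  classical
  by_contra hne
  obtain ⟨⟨b, r, c⟩, hq⟩ : ∃ q, flips i q ≠ flips j q := by
    by_contra! h'
    exact hne (funext h')
  have hall : ∀ c' : Fin n, flips i (b, r, c') ≠ 0 ∨ flips j (b, r, c') ≠ 0 := by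
    intro c'
    by_contra! h'
    have h1 := h b r c c'
    rw [Pi.add_apply, Pi.add_apply, h'.1, h'.2, add_zero] at h1
    refine hq ?_
    rw [← add_zero (flips i _), ← bit_add_self (flips j (b, r, c)), ← add_assoc, h1, zero_add]
  have hsub : (Finset.univ : Finset (Fin n)) ⊆
      ((Finset.univ.filter fun l => i l ≠ 0) ∪ Finset.univ.filter fun l => j l ≠ 0).image
        fun l : C.Loc => (l.gate b).2 := by
    intro c' _
    rw [Finset.mem_image]
    rcases hall c' with h1 | h1
    · obtain ⟨l, hl, hl'⟩ := exists_of_flips_ne_zero h1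
      exact ⟨l, by simp [hl], by rw [hl']⟩
    · obtain ⟨l, hl, hl'⟩ := exists_of_flips_ne_zero h1
      exact ⟨l, by simp [hl], by rw [hl']⟩
  have h1 := (Finset.card_le_card hsub).trans
    (Finset.card_image_le.trans (Finset.card_union_le _ _))
  rw [Finset.card_univ, Fintype.card_fin] at h1
  exact absurd hw (not_lt.2 h1)

/-- Gates sharing a qubit in one block act on the same pair of rows in every other block. -/
def PairLocal (C : CCZCircuit m n) : Prop :=
  ∀ (l l' : C.Loc) (b b' : Fin 3), b' ≠ b → l.gate b' = l'.gate b' →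
    (l.gate b).1.val / 2 = (l'.gate b).1.val / 2

/-- Each fault of either pattern is charged to the pair of rows that its gate meets in block `b`. If
every row were affected, each pair would carry at least as many faults as it has rows, and the total
weight would be at least `m`. -/
lemma PairLocal.exists_unaffected (hC : C.PairLocal) (f : Bool → C.FaultPattern)
    (hf : ∀ s s', flips (f s) = flips (f s')) (hw : weight (f true) + weight (f false) < m)
    (b : Fin 3) : ∃ r, ∀ s, Unaffected (f s) b r := by
  classical
  by_contra! hcon
  let F : Finset (Bool × C.Loc) := Finset.univ.filter fun x => f x.1 x.2 ≠ 0
  have hF : F.card = weight (f true) + weight (f false) := by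
    have : F = (Finset.univ.filter fun l => f true l ≠ 0).map
          ⟨Prod.mk true, Prod.mk_right_injective _⟩ ∪
        (Finset.univ.filter fun l => f false l ≠ 0).map
          ⟨Prod.mk false, Prod.mk_right_injective _⟩ := by
      ext ⟨s, l⟩
      cases s <;> simp [F]
    rw [this, Finset.card_union_of_disjoint, Finset.card_map, Finset.card_map, weight, weight]
    rw [Finset.disjoint_left]
    rintro ⟨s, l⟩ h1 h2
    cases s <;> simp at h1 h2
  have hpair : ∀ p : ℕ, ((Finset.univ : Finset (Fin m)).filter fun r => r.val / 2 = p).card ≤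
      (F.filter fun x => (x.2.gate b).1.val / 2 = p).card := by
    intro p
    -- An affected row is hit by a failing gate, or receives spread from a flip in another block; by
    -- pair locality the gate causing that flip lies over the same pair.
    have hex : ∀ r : Fin m, r.val / 2 = p → ∃ s l, f s l ≠ 0 ∧ (l.gate b).1.val / 2 = p ∧
        ((l.gate b).1 = r ∨ ∃ b', b' ≠ b ∧ xbit (f s l b') ≠ 0) := by
      intro r hrp
      obtain ⟨s, hs⟩ := hcon r
      rw [Unaffected] at hs
      push Not at hs
      obtain ⟨l, hl, hs⟩ := hs
      by_cases h0 : f s l = 0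
      · obtain ⟨l', b', hb', hll, hx⟩ := hs h0
        refine ⟨s, l', fun h => hx (by simp [h]), ?_, Or.inr ⟨b', hb', hx⟩⟩
        rw [hC l' l b b' hb' hll, hl, hrp]
      · exact ⟨s, l, h0, by rw [hl, hrp], Or.inl hl⟩
    rcases Nat.lt_or_ge 1 (F.filter fun x => (x.2.gate b).1.val / 2 = p).card with h2 | h1
    · refine le_trans ?_ h2
      by_contra! h3
      obtain ⟨r₁, k₁, r₂, k₂, r₃, k₃, h12, h13, h23⟩ := Finset.two_lt_card.1 h3
      simp only [Finset.mem_filter, Finset.mem_univ, true_and] at k₁ k₂ k₃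
      simp only [ne_eq, Fin.ext_iff] at h12 h13 h23
      omega
    · rcases Finset.eq_empty_or_nonempty
        ((Finset.univ : Finset (Fin m)).filter fun r => r.val / 2 = p) with he | ⟨r₀, hr₀⟩
      · simp [he]
      · obtain ⟨s₀, l₀, hf₀, hp₀, -⟩ := hex r₀ (by simpa using hr₀)
        have hmem₀ : (s₀, l₀) ∈ F.filter fun x => (x.2.gate b).1.val / 2 = p := by
          simp [F, hf₀, hp₀]
        have huniq : ∀ s l, f s l ≠ 0 → (l.gate b).1.val / 2 = p → s = s₀ ∧ l = l₀ := by
          intro s l h h'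
          have := Finset.card_le_one.1 h1 (s, l) (by simp [F, h, h']) (s₀, l₀) hmem₀
          exact ⟨congrArg Prod.fst this, congrArg Prod.snd this⟩
        refine le_trans (Finset.card_le_one.2 ?_) (Finset.card_pos.2 ⟨_, hmem₀⟩)
        -- A lone fault affects only its own row: a flip that spreads must also occur in the other
        -- pattern, whose flips are equal, and this costs a second fault over the pair.
        have hrow : ∀ r : Fin m, r.val / 2 = p → (l₀.gate b).1 = r := by
          intro r hr
          obtain ⟨s, l, h3, h4, h5⟩ := hex r hr
          obtain ⟨rfl, rfl⟩ := huniq s l h3 h4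
          refine h5.resolve_right ?_
          rintro ⟨b', hb', hx⟩
          -- No other error of `f s` can cancel this flip, since its gate would lie over the same
          -- pair.
          have h6 : flips (f s) (b', l.gate b') ≠ 0 := by
            rw [flips, Finset.sum_apply, Finset.sum_eq_single l]
            · simpa [gateFlip] using hx
            · intro l' _ hl'
              rw [gateFlip]
              split_ifs with h7
              · by_cases h8 : f s l' = 0
                · simp [h8]
                · exact absurd (huniq s l' h8 ((hC l' l b b' hb' h7).trans h4)).2 hl'
              · rfl
            · simp
          rw [hf s (!s)] at h6
          obtain ⟨l', h7, h8⟩ := exists_of_flips_ne_zero h6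
          have := (huniq (!s) l' h7 ((hC l' l b b' hb' h8).trans h4)).1
          simp at this
        intro r hr r' hr'
        simp only [Finset.mem_filter, Finset.mem_univ, true_and] at hr hr'
        rw [← hrow r hr, ← hrow r' hr']
  have h1 := Finset.card_eq_sum_card_fiberwise (s := (Finset.univ : Finset (Fin m)))
    (t := Finset.range m) (f := fun r : Fin m => r.val / 2)
    (fun r _ => by simp; omega)
  have h2 := Finset.card_eq_sum_card_fiberwise (s := F)
    (t := Finset.range m) (f := fun x => (x.2.gate b).1.val / 2)
    (fun x _ => by simp; omega)
  rw [Finset.card_univ, Fintype.card_fin] at h1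
  have h3 := Finset.sum_le_sum fun p (_ : p ∈ Finset.range m) => hpair p
  omega

theorem PairLocal.hasEffectiveDistanceSPR [NeZero m] [NeZero n] (hC : C.PairLocal) (hmn : m ≤ n) :
    C.HasEffectiveDistanceSPR m := by
  refine hasEffectiveDistanceSPR_of_core fun i j hw α => ?_
  by_cases h : RowConst (flips i + flips j)
  · have hij := flips_eq_of_rowConst h (hw.trans_le hmn)
    refine commutesWithLogicals_core hij (fun b => ?_) α
    obtain ⟨r, hr⟩ := hC.exists_unaffected (fun s => if s then i else j)
      (fun s s' => by cases s <;> cases s' <;> simp [hij]) (by simpa using hw) b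
    exact ⟨r, relPhase_add_rowFlip (hr true), relPhase_add_rowFlip (hr false)⟩
  · rw [core_eq_zero h]
    exact commutesWithLogicals_zero

end CCZCircuit

/-! ### Circuits acting as the logical gate -/

lemma two_inv_mul_one_sub_sgn (x : Fin 2) : (2⁻¹ : ℂ) * (1 - sgn x) = if x = 1 then 1 else 0 := by
  fin_cases x <;> norm_num

lemma logicalCCZ_eq_mono [NeZero n] : logicalCCZ m n = mono 0 fun t =>
    sgn ((∑ i, t (0, i, 0)) * (∑ i, t (1, i, 0)) * ∑ i, t (2, i, 0)) := by
  have h : ∀ b, (2⁻¹ : ℂ) • (1 - logicalZ m n b) =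
      Matrix.diagonal fun t => if ∑ i, t (b, i, 0) = 1 then 1 else 0 := by
    intro b
    rw [logicalZ_eq_mono, ← diagonal_eq_mono, ← Matrix.diagonal_one, Matrix.diagonal_sub,
      ← Matrix.diagonal_smul]
    congr 1
    funext t
    rw [Pi.smul_apply, smul_eq_mul, logicalPhase_eq_sgn, two_inv_mul_one_sub_sgn]
  rw [logicalCCZ, h, h, h, Matrix.diagonal_mul_diagonal, Matrix.diagonal_mul_diagonal,
    ← Matrix.diagonal_one, ← Matrix.diagonal_smul, Matrix.diagonal_sub, ← diagonal_eq_mono]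
  congr 1
  funext t
  simp only [Pi.smul_apply, smul_eq_mul]
  generalize ∑ i, t (0, i, 0) = x
  generalize ∑ i, t (1, i, 0) = y
  generalize ∑ i, t (2, i, 0) = z
  fin_cases x <;> fin_cases y <;> fin_cases z <;> norm_num

namespace CCZCircuit

variable {C : CCZCircuit m n}

/-- Both operators are diagonal, and the code projector lives on row-constant states, with nonzero
diagonal entries there; only the phases on these states are compared. -/
lemma implementsLogicalCCZ_iff [NeZero m] [NeZero n] : C.ImplementsLogicalCCZ ↔
    ∀ a : Fin 3 → Fin m → Fin 2,
      ∏ l : C.Loc, sgn (a 0 (l.gate 0).1 * a 1 (l.gate 1).1 * a 2 (l.gate 2).1) =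
        sgn ((∑ i, a 0 i) * (∑ i, a 1 i) * ∑ i, a 2 i) := by
  have hP := commutesWithLogicals_codeProj (m := m) (n := n)
  rw [ImplementsLogicalCCZ, idealOp_eq_mono, logicalCCZ_eq_mono]
  constructor
  · intro h a
    have h1 := congrFun (congrFun h (ofRows n a)) (ofRows n a)
    rw [mono_mul_apply, mono_mul_apply, add_zero,
      hP.apply_eq (rowConst_ofRows a) (rowConst_ofRows a) fun _ => rfl] at h1
    exact mul_right_cancel₀ codeProj_zero_zero_ne_zero h1
  · intro h
    ext s t
    rw [mono_mul_apply, mono_mul_apply, add_zero]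
    by_cases hs : RowConst s
    · congr 1
      rw [hs.eq_ofRows]
      exact h fun b i => s (b, i, 0)
    · have : codeProj m n s t = 0 := by
        by_contra h0
        exact hs (hP.support h0).1
      rw [this, mul_zero, mul_zero]

/-! ### A fault-tolerant circuit -/

/-- The gate for a triple of rows: in each block, the column is given by the pairs of rows that
the gate acts on in the other blocks. -/
def pairGate {k : ℕ} (hm : m ≤ 2 * k) (hn : k ^ 2 ≤ n) (a : Fin 3 → Fin m) : CCZGate m n :=
  fun b => (a b, ⟨(a (b + 1)).val / 2 * k + (a (b + 2)).val / 2, by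
    have h1 : (a (b + 1)).val / 2 < k := by omega
    have h2 : (a (b + 2)).val / 2 < k := by omega
    nlinarith⟩)

lemma pairGate_injective {k : ℕ} (hm : m ≤ 2 * k) (hn : k ^ 2 ≤ n) :
    Function.Injective (pairGate hm hn) :=
  fun _ _ h => funext fun b => congrArg Prod.fst (congrFun h b)

/-- The column is a two-digit number in base `k`, whose digits are the pairs in the other two
blocks. -/
lemma pairGate_share {k : ℕ} (hm : m ≤ 2 * k) (hn : k ^ 2 ≤ n) {a a' : Fin 3 → Fin m}
    {b b' : Fin 3} (hb : b' ≠ b) (h : pairGate hm hn a b' = pairGate hm hn a' b') :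
    (a b).val / 2 = (a' b).val / 2 := by
  simp only [pairGate, Prod.mk.injEq, Fin.mk.injEq] at h
  have h1 : (a (b' + 2)).val / 2 < k := by omega
  have h2 : (a' (b' + 2)).val / 2 < k := by omega
  have h3 : ∀ p q p' q' : ℕ, q < k → q' < k → p * k + q = p' * k + q' → p = p' ∧ q = q' := by
    intro p q p' q' hq hq' he
    have hp : p = p' := by
      rcases lt_trichotomy p p' with h | h | h
      · nlinarith
      · exact h
      · nlinarith
    subst hp
    exact ⟨rfl, by omega⟩
  obtain ⟨h4, h5⟩ := h3 _ _ _ _ h1 h2 h.2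
  have h6 : b = b' + 1 ∨ b = b' + 2 := by
    revert hb
    clear * -
    revert b b'
    decide
  rcases h6 with rfl | rfl
  · exact h4
  · exact h5

/-- The circuit that applies one gate for each triple of rows, one after the other. -/
def pairCircuit {k : ℕ} (hm : m ≤ 2 * k) (hn : k ^ 2 ≤ n) : CCZCircuit m n where
  depth := Fintype.card (Fin 3 → Fin m)
  step := fun t => {pairGate hm hn ((Fintype.equivFin _).symm t)}
  disjoint := by
    intro t g hg g' hg' hne
    rw [Finset.mem_singleton] at hg hg'
    exact absurd (hg.trans hg'.symm) hne

/-- The locations of the circuit correspond to the triples of rows. -/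
def pairCircuitLoc {k : ℕ} (hm : m ≤ 2 * k) (hn : k ^ 2 ≤ n) :
    (Fin 3 → Fin m) ≃ (pairCircuit (n := n) hm hn).Loc :=
  Equiv.ofBijective
    (fun a => ⟨Fintype.equivFin _ a, ⟨pairGate hm hn a, by simp [pairCircuit]⟩⟩) <| by
      refine ⟨fun a a' h => (Fintype.equivFin _).injective (congrArg Sigma.fst h), ?_⟩
      rintro ⟨t, g, hg⟩
      obtain ⟨a, rfl⟩ := (Fintype.equivFin (Fin 3 → Fin m)).surjective t
      have h : g = pairGate hm hn a := by simpa [pairCircuit] using hg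
      subst h
      exact ⟨a, rfl⟩

lemma pairCircuitLoc_gate {k : ℕ} (hm : m ≤ 2 * k) (hn : k ^ 2 ≤ n) (a : Fin 3 → Fin m) :
    (pairCircuitLoc hm hn a).gate = pairGate hm hn a := rfl

lemma pairCircuit_noRepeatedGate {k : ℕ} (hm : m ≤ 2 * k) (hn : k ^ 2 ≤ n) :
    (pairCircuit (n := n) hm hn).NoRepeatedGate := by
  intro t t' h
  refine Finset.disjoint_singleton.2 ?_
  exact fun h' => h ((Fintype.equivFin _).symm.injective (pairGate_injective hm hn h'))

lemma pairCircuit_pairLocal {k : ℕ} (hm : m ≤ 2 * k) (hn : k ^ 2 ≤ n) :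
    (pairCircuit (n := n) hm hn).PairLocal := by
  intro l l' b b' hb h
  obtain ⟨a, rfl⟩ := (pairCircuitLoc hm hn).surjective l
  obtain ⟨a', rfl⟩ := (pairCircuitLoc hm hn).surjective l'
  exact pairGate_share hm hn hb h

open scoped Fin.CommRing in
-- Expanding the product of the three row sums gives one monomial, hence one gate, per triple of
-- rows.
lemma pairCircuit_implementsLogicalCCZ [NeZero m] [NeZero n] {k : ℕ} (hm : m ≤ 2 * k)
    (hn : k ^ 2 ≤ n) : (pairCircuit (n := n) hm hn).ImplementsLogicalCCZ := by
  rw [implementsLogicalCCZ_iff]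
  intro a
  rw [← (pairCircuitLoc hm hn).prod_comp, ← sgn_sum]
  congr 1
  have h := (Finset.prod_univ_sum (fun _ : Fin 3 => (Finset.univ : Finset (Fin m))) a).symm
  rw [Fintype.piFinset_univ] at h
  simpa [Fin.prod_univ_three, pairCircuitLoc_gate, pairGate] using h

end CCZCircuit

section BinaryMatrices

/-! ### Binary matrices whose row and column spaces have small weights -/

open scoped Fin.CommRing Matrix

/-- The support of a bit vector. -/
def supp {ι : Type*} [Fintype ι] (v : ι → Fin 2) : Finset ι := Finset.univ.filter fun i => v i ≠ 0

lemma mem_supp {ι : Type*} [Fintype ι] {v : ι → Fin 2} {i : ι} : i ∈ supp v ↔ v i ≠ 0 := by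
  simp [supp]

lemma three_le_card_of_mem {ι : Type*} {s : Finset ι} {a b c : ι} (ha : a ∈ s) (hb : b ∈ s)
    (hc : c ∈ s) (hab : a ≠ b) (hac : a ≠ c) (hbc : b ≠ c) : 2 < s.card :=
  Finset.two_lt_card.2 ⟨a, ha, b, hb, c, hc, hab, hac, hbc⟩

lemma bit_add_ne_zero_iff {x y : Fin 2} (h : y ≠ 0) : x + y ≠ 0 ↔ x = 0 := by
  fin_cases x <;> fin_cases y <;> simp at h ⊢

/-- A binary linear code with weights at most `2` that involves at least three coordinates has no
word of weight `1`. -/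
lemma card_supp_ne_one {ι : Type*} [Fintype ι] {V : Set (ι → Fin 2)}
    (hadd : ∀ v ∈ V, ∀ w ∈ V, v + w ∈ V) (hV : ∀ v ∈ V, (supp v).card ≤ 2) {R : Finset ι}
    (hR : 2 < R.card) (hcov : ∀ r ∈ R, ∃ v ∈ V, v r ≠ 0) {v : ι → Fin 2} (hv : v ∈ V) :
    (supp v).card ≠ 1 := by
  classical
  intro h1
  obtain ⟨a, ha⟩ := Finset.card_eq_one.1 h1
  have hva : ∀ i, v i ≠ 0 ↔ i = a := fun i => by rw [← mem_supp, ha, Finset.mem_singleton]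
  have hv0 : ∀ i, i ≠ a → v i = 0 := fun i hi => not_not.1 fun h => hi ((hva i).1 h)
  -- Given the unit vector `v` at `a`, a word nonzero at `b` can be made zero at `a`. A third
  -- coordinate would give its sum with `v` weight three, so it is a unit vector too.
  have hsingle : ∀ b ∈ R, b ≠ a → ∃ w ∈ V, w b ≠ 0 ∧ ∀ i, i ≠ b → w i = 0 := by
    intro b hb hba
    obtain ⟨w, hw, hwa, hwb⟩ : ∃ w ∈ V, w a = 0 ∧ w b ≠ 0 := by
      obtain ⟨w, hw, hwb⟩ := hcov b hb
      by_cases hwa : w a = 0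
      · exact ⟨w, hw, hwa, hwb⟩
      · refine ⟨v + w, hadd v hv w hw, ?_, ?_⟩
        · exact not_not.1 fun h => (hva a).2 rfl ((bit_add_ne_zero_iff hwa).1 h)
        · rwa [Pi.add_apply, hv0 b hba, zero_add]
    refine ⟨w, hw, hwb, fun i hib => ?_⟩
    by_contra hi
    have hia : i ≠ a := fun h => hi (h ▸ hwa)
    refine absurd (hV _ (hadd v hv w hw)) (not_le.2 (three_le_card_of_mem (a := a) (b := b) (c := i)
      ?_ ?_ ?_ hba.symm hia.symm hib.symm))
    · rw [mem_supp, Pi.add_apply, hwa, add_zero]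
      exact (hva a).2 rfl
    · rwa [mem_supp, Pi.add_apply, hv0 b hba, zero_add]
    · rwa [mem_supp, Pi.add_apply, hv0 i hia, zero_add]
  have h2 : 1 < (R.erase a).card := by
    have := Finset.pred_card_le_card_erase (s := R) (a := a)
    omega
  obtain ⟨b, hb, c, hc, hbc⟩ := Finset.one_lt_card.1 h2
  rw [Finset.mem_erase] at hb hc
  obtain ⟨w, hw, hwb, hw0⟩ := hsingle b hb.2 hb.1
  obtain ⟨w', hw', hwc, hw0'⟩ := hsingle c hc.2 hc.1
  -- Three unit vectors at distinct places add up to a word of weight three.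
  refine absurd (hV _ (hadd _ (hadd v hv w hw) w' hw')) (not_le.2 (three_le_card_of_mem
    (a := a) (b := b) (c := c) ?_ ?_ ?_ hb.1.symm hc.1.symm hbc))
  · rw [mem_supp, Pi.add_apply, Pi.add_apply, hw0 a hb.1.symm, hw0' a hc.1.symm, add_zero, add_zero]
    exact (hva a).2 rfl
  · rwa [mem_supp, Pi.add_apply, Pi.add_apply, hv0 b hb.1, hw0' b hbc, zero_add, add_zero]
  · rwa [mem_supp, Pi.add_apply, Pi.add_apply, hv0 c hc.1, hw0 c hbc.symm, zero_add, zero_add]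

variable {ι κ : Type*} [Fintype ι] [Fintype κ]

lemma card_supp_col_le [DecidableEq κ] {M : Matrix ι κ (Fin 2)}
    (h : ∀ y, (supp (M *ᵥ y)).card ≤ 2) (c : κ) :
    (supp fun r => M r c).card ≤ 2 := by
  have := h (Pi.single c 1)
  rwa [Matrix.mulVec_single_one] at this

lemma card_supp_col_ne_one [DecidableEq κ] {M : Matrix ι κ (Fin 2)}
    (h : ∀ y, (supp (M *ᵥ y)).card ≤ 2)
    {R : Finset ι} (hR : 2 < R.card) (hcov : ∀ r ∈ R, ∃ c, M r c ≠ 0) (c : κ) :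
    (supp fun r => M r c).card ≠ 1 := by
  have hcol : ∀ c, (fun r => M r c) ∈ Set.range fun y => M *ᵥ y :=
    fun c => ⟨Pi.single c 1, Matrix.mulVec_single_one M c⟩
  refine card_supp_ne_one (V := Set.range fun y => M *ᵥ y) ?_ ?_ hR (fun r hr => ?_) (hcol c)
  · rintro _ ⟨y, rfl⟩ _ ⟨y', rfl⟩
    exact ⟨y + y', Matrix.mulVec_add M y y'⟩
  · rintro _ ⟨y, rfl⟩
    exact h y
  · obtain ⟨c', hc'⟩ := hcov r hr
    exact ⟨_, hcol c', hc'⟩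

/-- The number of nonzero rows is at least half the number of ones, if rows have weight at
most `2`. -/
lemma card_ones_le_two_mul [DecidableEq ι] {M : Matrix ι κ (Fin 2)}
    (h : ∀ r, (supp (M r)).card ≤ 2) :
    ∃ R : Finset ι, (∀ r ∈ R, ∃ c, M r c ≠ 0) ∧
      (supp fun p : ι × κ => M p.1 p.2).card ≤ 2 * R.card := by
  refine ⟨(supp fun p : ι × κ => M p.1 p.2).image Prod.fst, fun r hr => ?_,
    Finset.card_le_mul_card_image _ 2 fun r _ => ?_⟩
  · obtain ⟨⟨r', c⟩, hp, rfl⟩ := Finset.mem_image.1 hr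
    rw [mem_supp] at hp
    exact ⟨c, hp⟩
  · refine le_trans (Finset.card_le_card_of_injOn Prod.snd ?_ ?_) (h r)
    · rintro ⟨r', c⟩ hp
      simp only [Finset.coe_filter, Set.mem_ofPred_eq, mem_supp] at hp
      rw [Finset.mem_coe, mem_supp]
      exact hp.2 ▸ hp.1
    · rintro ⟨r₁, c₁⟩ h₁ ⟨r₂, c₂⟩ h₂ h12
      simp only [Finset.coe_filter, Set.mem_ofPred_eq] at h₁ h₂ h12
      rw [h₁.2, h₂.2, h12]

/-- A binary matrix has at most four ones if the weights in its row and column spaces are at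
most `2`, and remain so when some entry is changed. -/
lemma card_ones_le_four [DecidableEq ι] [DecidableEq κ] {M : Matrix ι κ (Fin 2)} {r₀ : ι} {c₀ : κ}
    (h1 : ∀ y, (supp (M *ᵥ y)).card ≤ 2) (h2 : ∀ y, (supp (Mᵀ *ᵥ y)).card ≤ 2)
    (h3 : ∀ y, (supp ((M + Matrix.single r₀ c₀ 1) *ᵥ y)).card ≤ 2) :
    (supp fun p : ι × κ => M p.1 p.2).card ≤ 4 := by
  by_contra! h5
  have hrow : ∀ r, (supp (M r)).card ≤ 2 := card_supp_col_le h2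
  -- Five ones in lines of weight at most two force at least three nonzero rows, and likewise
  -- columns; so no line has weight one.
  obtain ⟨R, hR, hRcard⟩ := card_ones_le_two_mul hrow
  obtain ⟨R', hR', hRcard'⟩ := card_ones_le_two_mul (M := Mᵀ) (card_supp_col_le h1)
  have h6 : (supp fun p : ι × κ => M p.1 p.2).card ≤ (supp fun p : κ × ι => Mᵀ p.1 p.2).card := by
    refine Finset.card_le_card_of_injOn Prod.swap ?_ (Prod.swap_injective.injOn)
    intro p hp
    rw [Finset.mem_coe, mem_supp] at hp ⊢
    exact hp
  have hrow1 : ∀ r, (supp (M r)).card ≠ 1 := card_supp_col_ne_one h2 (R := R') (by omega) hR'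
  have hcol1 := card_supp_col_ne_one h1 (R := R) (by omega) hR c₀
  have hcol2 := card_supp_col_le h1 c₀
  -- Every nonzero row of `M` has weight two and keeps an entry outside column `c₀`, so the changed
  -- matrix still has three nonzero rows.
  have hcol1' := card_supp_col_ne_one h3 (R := R) (by omega) (c := c₀) (fun r hr => by
    obtain ⟨c, hc⟩ := hR r hr
    have hpos : 0 < (supp (M r)).card := Finset.card_pos.2 ⟨c, mem_supp.2 hc⟩
    obtain ⟨c', hc', hne⟩ := Finset.exists_mem_ne (s := supp (M r))
      (by have := hrow1 r; omega) c₀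
    refine ⟨c', ?_⟩
    rw [Matrix.add_apply, Matrix.single_apply_of_ne, add_zero]
    · exact mem_supp.1 hc'
    · exact fun h => hne h.2.symm)
  have hcol2' := card_supp_col_le h3 c₀
  have hoff : ∀ r, r ≠ r₀ → (M + Matrix.single r₀ c₀ 1 : Matrix ι κ (Fin 2)) r c₀ = M r c₀ := by
    intro r hr
    rw [Matrix.add_apply, Matrix.single_apply_of_ne, add_zero]
    exact fun h => hr h.1.symm
  have hon : (M + Matrix.single r₀ c₀ 1 : Matrix ι κ (Fin 2)) r₀ c₀ = M r₀ c₀ + 1 := by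
    rw [Matrix.add_apply, Matrix.single_apply_same]
  -- Changing one entry alters the weight of column `c₀` by one, but it must be 0 or 2 both before
  -- and after.
  by_cases h0 : M r₀ c₀ = 0
  · have : supp (fun r => (M + Matrix.single r₀ c₀ 1 : Matrix ι κ (Fin 2)) r c₀) =
        insert r₀ (supp fun r => M r c₀) := by
      ext r
      rw [mem_supp, Finset.mem_insert, mem_supp]
      by_cases hr : r = r₀
      · subst hr
        simp [hon, h0]
      · simp [hoff r hr, hr]
    rw [this, Finset.card_insert_of_notMem (by simp [mem_supp, h0])] at hcol1' hcol2'
    omega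
  · have : supp (fun r => (M + Matrix.single r₀ c₀ 1 : Matrix ι κ (Fin 2)) r c₀) =
        (supp fun r => M r c₀).erase r₀ := by
      ext r
      rw [mem_supp, Finset.mem_erase, mem_supp]
      by_cases hr : r = r₀
      · subst hr
        simp [hon, bit_ne_zero_iff.1 h0, bit_add_self]
      · simp [hoff r hr, hr]
    have hmem : r₀ ∈ supp fun r => M r c₀ := mem_supp.2 h0
    rw [this, Finset.card_erase_of_mem hmem] at hcol1'
    have := Finset.card_pos.2 ⟨_, hmem⟩
    omega

/-! ### Sums of signs of bilinear forms -/

lemma sum_sgn_dotProduct {m : ℕ} (z : Fin m → Fin 2) :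
    ∑ u : Fin m → Fin 2, sgn (u ⬝ᵥ z) = if z = 0 then (2 : ℂ) ^ m else 0 := by
  split_ifs with h
  · simp [h]
  · obtain ⟨i, hi⟩ : ∃ i, z i ≠ 0 := by
      by_contra! h'
      exact h (funext h')
    have h1 := Equiv.sum_comp (Equiv.addRight (Pi.single i 1 : Fin m → Fin 2)) fun u => sgn (u ⬝ᵥ z)
    simp only [Equiv.coe_addRight, add_dotProduct, sgn_add, single_one_dotProduct,
      bit_ne_zero_iff.1 hi, sgn_one, mul_neg_one, Finset.sum_neg_distrib] at h1
    linear_combination (-1 / 2 : ℂ) * h1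

/-- A translation of `a β'` absorbs `y`. Averaging over translations of `a β` then leaves, by
orthogonality of characters, the number of `a` with `M *ᵥ a β' = 0`, which is positive because of `a
= 0`. -/
lemma sum_sgn_bilinear_ne_zero {m : ℕ} {β β' : Fin 3} (hβ : β ≠ β')
    (M : Matrix (Fin m) (Fin m) (Fin 2)) (y : Fin m → Fin 2) :
    ∑ a : Fin 3 → Fin m → Fin 2, sgn (a β ⬝ᵥ M *ᵥ (y + a β')) ≠ 0 := by
  classical
  have h1 : ∑ a : Fin 3 → Fin m → Fin 2, sgn (a β ⬝ᵥ M *ᵥ (y + a β')) =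
      ∑ a : Fin 3 → Fin m → Fin 2, sgn (a β ⬝ᵥ M *ᵥ a β') := by
    rw [← Equiv.sum_comp (Equiv.addLeft (Pi.single β' y : Fin 3 → Fin m → Fin 2))
      fun a => sgn (a β ⬝ᵥ M *ᵥ a β')]
    simp [hβ]
  have h2 : ∀ u : Fin m → Fin 2, ∑ a : Fin 3 → Fin m → Fin 2, sgn (a β ⬝ᵥ M *ᵥ a β') =
      ∑ a : Fin 3 → Fin m → Fin 2, sgn ((u + a β) ⬝ᵥ M *ᵥ a β') := by
    intro u
    rw [← Equiv.sum_comp (Equiv.addLeft (Pi.single β u : Fin 3 → Fin m → Fin 2))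
      fun a => sgn (a β ⬝ᵥ M *ᵥ a β')]
    simp [hβ.symm]
  have h3 : (2 : ℂ) ^ m * ∑ a : Fin 3 → Fin m → Fin 2, sgn (a β ⬝ᵥ M *ᵥ a β') =
      ∑ a : Fin 3 → Fin m → Fin 2, if M *ᵥ a β' = 0 then (2 : ℂ) ^ m else 0 := by
    have h4 : (2 : ℂ) ^ m * ∑ a : Fin 3 → Fin m → Fin 2, sgn (a β ⬝ᵥ M *ᵥ a β') =
        ∑ u : Fin m → Fin 2, ∑ a : Fin 3 → Fin m → Fin 2, sgn ((u + a β) ⬝ᵥ M *ᵥ a β') := by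
      rw [← Finset.sum_congr rfl fun u _ => h2 u]
      simp
    rw [h4, Finset.sum_comm]
    refine Finset.sum_congr rfl fun a _ => ?_
    rw [← sum_sgn_dotProduct]
    exact Equiv.sum_comp (Equiv.addRight (a β)) fun u => sgn (u ⬝ᵥ M *ᵥ a β')
  rw [h1]
  intro h0
  rw [h0, mul_zero, ← Finset.sum_filter, Finset.sum_const, nsmul_eq_mul] at h3
  have h5 : (Finset.univ.filter fun a : Fin 3 → Fin m → Fin 2 => M *ᵥ a β' = 0).card ≠ 0 :=
    Finset.card_ne_zero.2 ⟨0, by simp⟩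
  exact mul_ne_zero (Nat.cast_ne_zero.2 h5) (pow_ne_zero m two_ne_zero) h3.symm

/-- If `M *ᵥ y` had weight at least three, the complement of its support would be an admissible `T`.
The linear part of the sign is then the pairing of `a β` with `M *ᵥ y`, and the sum cannot vanish by
`sum_sgn_bilinear_ne_zero`. -/
lemma card_supp_mulVec_le_two {m : ℕ} {β β' : Fin 3} (hβ : β ≠ β')
    {M : Matrix (Fin m) (Fin m) (Fin 2)}
    (h : ∀ T : Finset (Fin m), T.card + 3 ≤ m → ∑ a : Fin 3 → Fin m → Fin 2,
      sgn (∑ i, a β i + ∑ r ∈ T, a β r + a β ⬝ᵥ M *ᵥ a β') = 0) (y : Fin m → Fin 2) :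
    (supp (M *ᵥ y)).card ≤ 2 := by
  by_contra! h3
  have hcard := Finset.card_add_card_compl (supp (M *ᵥ y))
  rw [Fintype.card_fin] at hcard
  have h1 := h (supp (M *ᵥ y))ᶜ (by omega)
  refine sum_sgn_bilinear_ne_zero hβ M y (Eq.trans (Finset.sum_congr rfl fun a _ => ?_) h1)
  rw [Matrix.mulVec_add, dotProduct_add]
  congr 2
  rw [← Finset.sum_add_sum_compl (supp (M *ᵥ y)), add_assoc, bit_add_self, add_zero, dotProduct,
    ← Finset.sum_add_sum_compl (supp (M *ᵥ y))]
  rw [Finset.sum_eq_zero (s := (supp (M *ᵥ y))ᶜ), add_zero]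
  · refine Finset.sum_congr rfl fun r hr => ?_
    rw [bit_ne_zero_iff.1 (mem_supp.1 hr), mul_one]
  · intro r hr
    rw [Finset.mem_compl, mem_supp, not_not] at hr
    rw [hr, mul_zero]

/-- The CZ sign is its own Fourier transform on two bits. -/
lemma sum_half_sgn (x y : Fin 2) : ∑ z : Fin 2 × Fin 2,
    (2⁻¹ * sgn (z.1 * z.2)) * sgn (z.1 * x + z.2 * y) = sgn (x * y) := by
  rw [Fintype.sum_prod_type]
  fin_cases x <;> fin_cases y <;> simp [Fin.sum_univ_two, bit_add_self] <;> norm_num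

/-- A `CZ` sign is a combination of `Z` signs. -/
lemma sum_mul_sgn_mul_eq_zero {A : Type*} [Fintype A] {W : A → ℂ} {x y : A → Fin 2}
    (h : ∀ z : Fin 2 × Fin 2, ∑ a, W a * sgn (z.1 * x a + z.2 * y a) = 0) :
    ∑ a, W a * sgn (x a * y a) = 0 := by
  rw [Finset.sum_congr rfl fun a _ => by rw [← sum_half_sgn, Finset.mul_sum], Finset.sum_comm]
  refine Finset.sum_eq_zero fun z _ => ?_
  rw [← mul_zero (2⁻¹ * sgn (z.1 * z.2)), ← h z, Finset.mul_sum]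
  exact Finset.sum_congr rfl fun a _ => by ring

end BinaryMatrices

namespace CCZCircuit

open scoped Fin.CommRing Matrix

variable {C : CCZCircuit m n}

/-! ### A flip fault together with phase faults -/

/-- The row that the gate at `l` acts on in block `b`. -/
def Loc.row (l : C.Loc) (b : Fin 3) : Fin m := (l.gate b).1

/-- The locations of gates on the qubit `q` of block `0`. -/
def gatesOn (C : CCZCircuit m n) (q : Fin m × Fin n) : Finset C.Loc :=
  Finset.univ.filter fun l => l.gate 0 = q

open Classical in
/-- After the gate at `l₀` an `X` error occurs in block `0`, together with `Z` errors in blocks `1`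
and `2` as prescribed by `z`; after the gates at `S` a `Z` error occurs in block `β`. -/
def flipFault (l₀ : C.Loc) (z : Fin 2 × Fin 2) (β : Fin 3) (S : Finset C.Loc) : C.FaultPattern :=
  fun l => if l = l₀ then ![1, if z.1 = 0 then 0 else 3, if z.2 = 0 then 0 else 3]
    else if l ∈ S then Pi.single β 3 else 0

lemma weight_flipFault_le (l₀ : C.Loc) (z : Fin 2 × Fin 2) (β : Fin 3) (S : Finset C.Loc) :
    weight (flipFault l₀ z β S) ≤ S.card + 1 := by
  classical
  refine (Finset.card_le_card (t := insert l₀ S) fun l hl => ?_).trans (Finset.card_insert_le _ _)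
  rw [Finset.mem_insert]
  by_contra! h
  exact (Finset.mem_filter.1 hl).2 (by simp [flipFault, h.1, h.2])

lemma gateFlip_flipFault_of_ne {l₀ l : C.Loc} (hl : l ≠ l₀) (z : Fin 2 × Fin 2) (β : Fin 3)
    (S : Finset C.Loc) : gateFlip l.gate (flipFault l₀ z β S l) = 0 := by
  have h : ∀ b, xbit ((Pi.single β 3 : Fin 3 → Fin 4) b) = 0 := by
    intro b
    by_cases hb : b = β
    · subst hb
      simp
    · simp [hb]
  funext q
  by_cases hS : l ∈ S <;> simp [gateFlip, flipFault, hl, hS, h]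

lemma gateFlip_flipFault_self (l₀ : C.Loc) (z : Fin 2 × Fin 2) (β : Fin 3) (S : Finset C.Loc) :
    gateFlip l₀.gate (flipFault l₀ z β S l₀) = Pi.single (0, l₀.gate 0) 1 := by
  have h : ∀ x : Fin 2, xbit (if x = 0 then 0 else 3) = 0 := by decide
  funext ⟨b, q⟩
  obtain rfl | rfl | rfl : b = 0 ∨ b = 1 ∨ b = 2 := by omega
  · by_cases hq : l₀.gate 0 = q
    · subst hq
      simp [gateFlip, flipFault]
    · simp [gateFlip, hq, Ne.symm hq]
  · simp [gateFlip, flipFault, h]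
  · simp [gateFlip, flipFault, h]

lemma flips_flipFault (l₀ : C.Loc) (z : Fin 2 × Fin 2) (β : Fin 3) (S : Finset C.Loc) :
    flips (flipFault l₀ z β S) = Pi.single (0, l₀.gate 0) 1 := by
  rw [flips, Finset.sum_eq_single l₀ (fun l _ hl => gateFlip_flipFault_of_ne hl z β S) (by simp),
    gateFlip_flipFault_self]

lemma flipsBefore_flipFault (l₀ : C.Loc) (z : Fin 2 × Fin 2) (β : Fin 3) (S : Finset C.Loc)
    (l : C.Loc) : flipsBefore (flipFault l₀ z β S) l =
      if C.pos l < C.pos l₀ then Pi.single (0, l₀.gate 0) 1 else 0 := by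
  rw [flipsBefore, Finset.sum_eq_single l₀ (fun l' _ hl' => ?_) (by simp), gateFlip_flipFault_self]
  rw [gateFlip_flipFault_of_ne hl', ite_self]

/-- The `Z` errors contribute the linear signs, and `β ≠ 0` keeps them away from the flip in block
0. The `X` error turns the later gates on its qubit into CZs; later means smaller `pos`, as
positions count from the end. -/
lemma relPhase_flipFault {l₀ : C.Loc} {z : Fin 2 × Fin 2} {β : Fin 3} (hβ : β ≠ 0)
    {S : Finset C.Loc} (hS : l₀ ∉ S) (a : Fin 3 → Fin m → Fin 2) :
    relPhase (flipFault l₀ z β S) (ofRows n a) =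
      sgn (z.1 * a 1 (l₀.row 1) + z.2 * a 2 (l₀.row 2)) * sgn (∑ l ∈ S, a β (l.row β)) *
        sgn (∑ l ∈ (C.gatesOn (l₀.gate 0)).filter fun l => C.pos l < C.pos l₀,
          a 1 (l.row 1) * a 2 (l.row 2)) := by
  classical
  have hX : ∀ l b q, b ≠ 0 → (ofRows n a + flipsBefore (flipFault l₀ z β S) l) (b, q) =
      a b q.1 := by
    intro l b q hb
    rw [flipsBefore_flipFault]
    split_ifs <;> simp [hb, ofRows]
  have h1 : ∀ l : C.Loc, gatePhase l.gate (flipFault l₀ z β S l)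
      (ofRows n a + flipsBefore (flipFault l₀ z β S) l) =
      (if l = l₀ then sgn (z.1 * a 1 (l₀.row 1) + z.2 * a 2 (l₀.row 2)) else 1) *
        if l ∈ S then sgn (a β (l.row β)) else 1 := by
    intro l
    rw [gatePhase]
    by_cases hl : l = l₀
    · subst hl
      have h3 : ∀ x y : Fin 2, pphase (if x = 0 then 0 else 3) y = sgn (x * y) := by
        intro x y
        obtain rfl | rfl : x = 0 ∨ x = 1 := by omega
        all_goals simp
      rw [Fin.prod_univ_three, hX l 1 _ (by decide), hX l 2 _ (by decide)]
      simp [flipFault, hS, h3, sgn_add, Loc.row]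
    · by_cases hlS : l ∈ S
      · rw [Finset.prod_eq_single β]
        · rw [hX l β _ hβ]
          simp [flipFault, hl, hlS, Loc.row]
        · intro b _ hb
          simp [flipFault, hl, hlS, hb]
        · simp
      · simp [flipFault, hl, hlS]
  have h2 : ∀ l : C.Loc, cczPhase l.gate (ofRows n a + flipsBefore (flipFault l₀ z β S) l) *
      cczPhase l.gate (ofRows n a) = if l ∈ (C.gatesOn (l₀.gate 0)).filter
        (fun l => C.pos l < C.pos l₀) then sgn (a 1 (l.row 1) * a 2 (l.row 2)) else 1 := by
    intro l
    rw [cczPhase, cczPhase, hX l 1 _ (by decide), hX l 2 _ (by decide), ← sgn_add,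
      flipsBefore_flipFault]
    simp only [Finset.mem_filter, gatesOn, Finset.mem_univ, true_and, Pi.add_apply]
    by_cases h : l.gate 0 = l₀.gate 0 <;> by_cases h' : C.pos l < C.pos l₀
    · rw [if_pos h', if_pos ⟨h, h'⟩, h, Pi.single_eq_same]
      congr 1
      simp only [ofRows, Loc.row]
      generalize a 0 _ = x, a 1 _ = y, a 2 _ = w
      revert x y w
      decide
    · rw [if_neg h', if_neg (by tauto)]
      simp [ofRows, bit_add_self]
    · rw [if_pos h', if_neg (by tauto), Pi.single_eq_of_ne (by simpa using h)]
      simp [ofRows, bit_add_self]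
    · rw [if_neg h', if_neg (by tauto)]
      simp [ofRows, bit_add_self]
  rw [relPhase]
  simp only [h1, h2, Finset.prod_mul_distrib, sgn_sum]
  congr 1
  · congr 1
    · simp
    · simp
  · rw [Finset.prod_ite_mem, Finset.univ_inter]

/-! ### Consequences of fault tolerance -/

lemma sum_rowConst [NeZero n] (F : State m n → ℂ) [DecidablePred (RowConst (m := m) (n := n))] :
    (∑ s, if RowConst s then F s else 0) = ∑ a, F (ofRows n a) := by
  rw [← Finset.sum_filter]
  symm
  refine Finset.sum_bij (fun a _ => ofRows n a) (fun a _ => ?_) (fun a _ a' _ h => ?_)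
    (fun s hs => ?_) fun a _ => rfl
  · simpa using rowConst_ofRows a
  · funext b i
    exact congrFun h (b, i, 0)
  · exact ⟨fun b i => s (b, i, 0), Finset.mem_univ _,
      ((Finset.mem_filter.1 hs).2.eq_ofRows).symm⟩

lemma sum_sgn_sum_eq_zero [NeZero m] (β : Fin 3) :
    ∑ a : Fin 3 → Fin m → Fin 2, sgn (∑ i, a β i) = 0 := by
  have h := Equiv.sum_comp
    (Equiv.addRight (Pi.single β (Pi.single 0 1) : Fin 3 → Fin m → Fin 2))
    fun a => sgn (∑ i, a β i)
  simp only [Equiv.coe_addRight, Pi.add_apply, Pi.single_eq_same, Finset.sum_add_distrib, sgn_add,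
    Finset.sum_pi_single', Finset.mem_univ, if_true, sgn_one, mul_neg_one,
    Finset.sum_neg_distrib] at h
  linear_combination (-1 / 2 : ℂ) * h

/-- The sum of all row-constant basis states and its image under the logical `Z` of block `β` are
orthogonal code states. Since the flips of the two errors cancel, their preserved orthogonality is a
sum of phases. -/
theorem HasEffectiveDistanceSPR.sum_relPhase_eq_zero [NeZero m] [NeZero n] {d : ℕ}
    (h : C.HasEffectiveDistanceSPR d) {i j : C.FaultPattern} (hw : weight i + weight j < d)
    (hx : flips i = flips j) (β : Fin 3) :
    ∑ a : Fin 3 → Fin m → Fin 2, sgn (∑ r, a β r) *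
      (star (relPhase i (ofRows n a)) * relPhase j (ofRows n a)) = 0 := by
  classical
  have hu := codeProj_mulVec (m := m) (n := n) (stabilizer_mulVec_codeState
    (w := logicalPhase β) fun b r r' s => by
      rw [logicalPhase_add, logicalPhase_add, logicalPhase_rowFlip, logicalPhase_rowFlip]
      split_ifs <;> simp)
  have hv := codeProj_mulVec (m := m) (n := n) (stabilizer_mulVec_codeState
    (w := fun _ => 1) fun _ _ _ _ => rfl)
  have hstar : ∀ s : State m n, star (logicalPhase β s) = logicalPhase β s := by
    intro s
    rw [logicalPhase_eq_sgn, star_sgn]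
  have h1 := h.orthogonal hw hu hv (by
    refine Eq.trans ?_ (sum_sgn_sum_eq_zero (m := m) β)
    rw [dotProduct]
    refine Eq.trans (Finset.sum_congr rfl fun s _ => ?_) (sum_rowConst fun s => logicalPhase β s)
      |>.trans (Finset.sum_congr rfl fun a _ => ?_)
    · by_cases hs : RowConst s
      · simp only [Pi.star_apply, if_pos hs, hstar, mul_one]
      · simp only [if_neg hs, mul_zero]
    · exact logicalPhase_eq_sgn β _)
  rw [mono_conjTranspose, mono_mul_mono, hx, bits_add_self, dotProduct] at h1
  rw [← h1]
  symm
  refine Eq.trans (Finset.sum_congr rfl fun s _ => ?_) (sum_rowConst fun s =>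
    logicalPhase β s * (star (relPhase i s) * relPhase j s)) |>.trans
      (Finset.sum_congr rfl fun a _ => ?_)
  · rw [mono_mulVec_apply, add_zero, bits_add_add_cancel]
    by_cases hs : RowConst s
    · simp only [Pi.star_apply, if_pos hs, hstar, mul_one]
    · simp only [if_neg hs, mul_zero]
  · rw [logicalPhase_eq_sgn]
    rfl

/-- The bilinear form of the phases that an `X` error on the qubit `q` of block `0` spreads to. -/
def spreadMatrix (C : CCZCircuit m n) (q : Fin m × Fin n) : Matrix (Fin m) (Fin m) (Fin 2) :=
  ∑ l ∈ C.gatesOn q, Matrix.single (l.row 1) (l.row 2) 1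

lemma dotProduct_single_mulVec (u v : Fin m → Fin 2) (r c : Fin m) :
    u ⬝ᵥ (Matrix.single r c (1 : Fin 2)) *ᵥ v = u r * v c := by
  rw [Matrix.single_mulVec, dotProduct, Finset.sum_eq_single r]
  · simp
  · intro b _ hb
    simp [hb]
  · simp

lemma dotProduct_spreadMatrix_mulVec (q : Fin m × Fin n) (u v : Fin m → Fin 2) :
    u ⬝ᵥ C.spreadMatrix q *ᵥ v = ∑ l ∈ C.gatesOn q, u (l.row 1) * v (l.row 2) := by
  rw [spreadMatrix, Matrix.sum_mulVec, dotProduct_sum]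
  exact Finset.sum_congr rfl fun l _ => dotProduct_single_mulVec u v _ _

/-- Every triple of rows has an odd number of gates. -/
lemma ImplementsLogicalCCZ.sum_eq_one [NeZero m] [NeZero n] (h : C.ImplementsLogicalCCZ)
    (ρ : Fin 3 → Fin m) :
    ∑ l : C.Loc, (if l.row 0 = ρ 0 ∧ l.row 1 = ρ 1 ∧ l.row 2 = ρ 2 then (1 : Fin 2) else 0) =
      1 := by
  have h1 := implementsLogicalCCZ_iff.1 h fun b => Pi.single (ρ b) 1
  rw [← sgn_sum] at h1
  have h2 := sgn_injective h1
  simp only [Finset.sum_pi_single', Finset.mem_univ, if_true, mul_one] at h2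
  refine Eq.trans (Finset.sum_congr rfl fun l _ => ?_) h2
  simp only [Pi.single_apply, Loc.row]
  by_cases h3 : (l.gate 0).1 = ρ 0 <;> by_cases h4 : (l.gate 1).1 = ρ 1 <;>
    by_cases h5 : (l.gate 2).1 = ρ 2 <;> simp [h3, h4, h5]

lemma ImplementsLogicalCCZ.exists_loc [NeZero m] [NeZero n] (h : C.ImplementsLogicalCCZ)
    (ρ : Fin 3 → Fin m) : ∃ l : C.Loc, l.row = ρ := by
  obtain ⟨l, -, hl⟩ := Finset.exists_ne_zero_of_sum_ne_zero
    ((h.sum_eq_one ρ).trans_ne one_ne_zero)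
  have h1 : l.row 0 = ρ 0 ∧ l.row 1 = ρ 1 ∧ l.row 2 = ρ 2 := by
    by_contra h'
    exact hl (if_neg h')
  refine ⟨l, funext fun b => ?_⟩
  obtain rfl | rfl | rfl : b = 0 ∨ b = 1 ∨ b = 2 := by omega
  exacts [h1.1, h1.2.1, h1.2.2]

/-- Sums of phases that vanish by comparing `X` errors after the first and after the last gate on a
qubit. -/
lemma sum_sgn_spread_eq_zero [NeZero m] [NeZero n] (hC : C.ImplementsLogicalCCZ)
    (hd : C.HasEffectiveDistanceSPR m) {q : Fin m × Fin n} {l₁ l₂ : C.Loc}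
    (h₁ : l₁ ∈ C.gatesOn q) (h₂ : l₂ ∈ C.gatesOn q)
    (hmax : ∀ l ∈ C.gatesOn q, C.pos l ≤ C.pos l₁) (hmin : ∀ l ∈ C.gatesOn q, C.pos l₂ ≤ C.pos l)
    {β : Fin 3} (hβ : β ≠ 0) {T : Finset (Fin m)} (hT : T.card + 3 ≤ m) (z : Fin 2 × Fin 2) :
    ∑ a : Fin 3 → Fin m → Fin 2,
      sgn (∑ i, a β i + ∑ r ∈ T, a β r + a 1 ⬝ᵥ C.spreadMatrix q *ᵥ a 2) *
      sgn (z.1 * a 1 (l₂.row 1) + z.2 * a 2 (l₂.row 2)) = 0 := by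
  classical
  have hq₁ : l₁.gate 0 = q := (Finset.mem_filter.1 h₁).2
  have hq₂ : l₂.gate 0 = q := (Finset.mem_filter.1 h₂).2
  -- The extra `Z` errors are placed on gates off the row of `q` in block 0, so that they never
  -- coincide with `l₂`.
  obtain ⟨r₀, hr₀⟩ : ∃ r₀ : Fin m, r₀ ≠ q.1 := by
    have : Nontrivial (Fin m) := Fin.nontrivial_iff_two_le.2 (by omega)
    exact exists_ne q.1
  choose G hG using fun r : Fin m => hC.exists_loc (fun b => if b = 0 then r₀ else r)
  have hG0 : ∀ r, (G r).row 0 = r₀ := fun r => by rw [hG]; simp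
  have hGβ : ∀ r, (G r).row β = r := fun r => by rw [hG]; simp [hβ]
  have hGinj : Function.Injective G := fun r r' h => by rw [← hGβ r, ← hGβ r', h]
  have hS : l₂ ∉ T.image G := by
    intro h
    obtain ⟨r, -, hr⟩ := Finset.mem_image.1 h
    refine hr₀ ?_
    rw [← hG0 r, hr, Loc.row, hq₂]
  -- Since `pos` counts from the end, `l₂` is the last gate on `q` and its `X` error spreads
  -- nowhere; `l₁` is the first, and its error spreads to all other gates on `q`.
  have hlast : (C.gatesOn (l₂.gate 0)).filter (fun l => C.pos l < C.pos l₂) = ∅ := by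
    rw [hq₂]
    exact Finset.filter_eq_empty_iff.2 fun l hl => not_lt.2 (hmin l hl)
  have hfirst : (C.gatesOn (l₁.gate 0)).filter (fun l => C.pos l < C.pos l₁) =
      (C.gatesOn q).erase l₁ := by
    rw [hq₁]
    ext l
    rw [Finset.mem_filter, Finset.mem_erase, and_comm]
    refine and_congr_left fun hl => ?_
    rw [lt_iff_le_and_ne, and_iff_right (hmax l hl), Ne, C.pos.injective.eq_iff]
  have key : ∀ z' : Fin 2 × Fin 2, ∑ a : Fin 3 → Fin m → Fin 2,
      (sgn (∑ i, a β i + ∑ r ∈ T, a β r + ∑ l ∈ (C.gatesOn q).erase l₁,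
        a 1 (l.row 1) * a 2 (l.row 2)) * sgn (z.1 * a 1 (l₂.row 1) + z.2 * a 2 (l₂.row 2))) *
        sgn (z'.1 * a 1 (l₁.row 1) + z'.2 * a 2 (l₁.row 2)) = 0 := by
    intro z'
    -- The bound `T.card + 3 ≤ m` leaves room for the two `X` faults; the `Z` errors in `z` and `z'`
    -- are free, being on the same failing gates.
    have hw : weight (flipFault l₂ z β (T.image G)) + weight (flipFault l₁ z' β ∅) < m := by
      have h3 := weight_flipFault_le l₂ z β (T.image G)
      have h4 := weight_flipFault_le l₁ z' β ∅
      have h5 := Finset.card_image_le (s := T) (f := G)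
      rw [Finset.card_empty] at h4
      omega
    have h3 := hd.sum_relPhase_eq_zero hw
      (by rw [flips_flipFault, flips_flipFault, hq₁, hq₂]) β
    rw [← h3]
    refine Finset.sum_congr rfl fun a _ => ?_
    rw [relPhase_flipFault hβ hS, relPhase_flipFault hβ (Finset.notMem_empty _), hlast, hfirst,
      Finset.sum_image fun r _ r' _ h => hGinj h]
    simp only [hGβ, Finset.sum_empty, sgn_zero, mul_one, star_mul', star_sgn, sgn_add]
    ring
  -- Combining the choices of `z'` supplies the missing CZ of `l₁` and completes the form to the
  -- whole spread matrix.
  refine Eq.trans (Finset.sum_congr rfl fun a _ => ?_) (sum_mul_sgn_mul_eq_zero key)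
  rw [dotProduct_spreadMatrix_mulVec, ← Finset.add_sum_erase _ _ h₁]
  simp only [sgn_add]
  ring

/-- Taking `z = 0` with `β = 1` and `β = 2` bounds the column and row spaces. Combining all `z`
yields the CZ of `l₂`, which changes one entry of the matrix. -/
lemma card_ones_spreadMatrix_le [NeZero m] [NeZero n] (hC : C.ImplementsLogicalCCZ)
    (hd : C.HasEffectiveDistanceSPR m) (q : Fin m × Fin n) :
    (supp fun p : Fin m × Fin m => C.spreadMatrix q p.1 p.2).card ≤ 4 := by
  rcases (C.gatesOn q).eq_empty_or_nonempty with he | hne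
  · simp [spreadMatrix, he, supp]
  obtain ⟨l₁, h₁, hmax⟩ := Finset.exists_max_image _ C.pos hne
  obtain ⟨l₂, h₂, hmin⟩ := Finset.exists_min_image _ C.pos hne
  have h := fun (β : Fin 3) (hβ : β ≠ 0) (T : Finset (Fin m)) (hT : T.card + 3 ≤ m) =>
    sum_sgn_spread_eq_zero hC hd h₁ h₂ hmax hmin hβ hT
  refine card_ones_le_four (r₀ := l₂.row 1) (c₀ := l₂.row 2) ?_ ?_ ?_
  · refine card_supp_mulVec_le_two (β := 1) (β' := 2) (by decide) fun T hT => ?_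
    simpa using h 1 (by decide) T hT 0
  · refine card_supp_mulVec_le_two (β := 2) (β' := 1) (by decide) fun T hT => ?_
    have h3 : ∀ a : Fin 3 → Fin m → Fin 2, a 2 ⬝ᵥ (C.spreadMatrix q)ᵀ *ᵥ a 1 =
        a 1 ⬝ᵥ C.spreadMatrix q *ᵥ a 2 := by
      intro a
      rw [Matrix.mulVec_transpose, dotProduct_comm, Matrix.dotProduct_mulVec]
    simpa [h3] using h 2 (by decide) T hT 0
  · refine card_supp_mulVec_le_two (β := 1) (β' := 2) (by decide) fun T hT => ?_
    refine Eq.trans (Finset.sum_congr rfl fun a _ => ?_)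
      (sum_mul_sgn_mul_eq_zero (h 1 (by decide) T hT))
    rw [Matrix.add_mulVec, dotProduct_add, dotProduct_single_mulVec, ← add_assoc, sgn_add]

/-- Each triple of rows has an odd number of gates, so every pair of rows of blocks 1 and 2 is a one
in the spread matrix of some qubit of row 0 in block 0. There are `n` such matrices with at most
four ones each. -/
theorem sq_le_four_mul [NeZero m] [NeZero n] (hC : C.ImplementsLogicalCCZ)
    (hd : C.HasEffectiveDistanceSPR m) : m ^ 2 ≤ 4 * n := by
  classical
  have hsum : ∀ r c : Fin m, ∑ j : Fin n, C.spreadMatrix (0, j) r c = 1 := by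
    intro r c
    have h1 := hC.sum_eq_one ![0, r, c]
    rw [← h1]
    simp only [spreadMatrix, Matrix.sum_apply, gatesOn, Finset.sum_filter]
    rw [Finset.sum_comm]
    refine Finset.sum_congr rfl fun l _ => ?_
    rw [Finset.sum_eq_single (l.gate 0).2]
    · by_cases h2 : (l.gate 0).1 = 0 <;>
        simp [Loc.row, Matrix.single_apply, Prod.ext_iff, h2]
    · intro j _ hj
      rw [if_neg]
      intro h2
      exact hj (by rw [h2])
    · simp
  have hcover : (Finset.univ : Finset (Fin m × Fin m)) ⊆ Finset.univ.biUnion fun j : Fin n =>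
      supp fun p : Fin m × Fin m => C.spreadMatrix (0, j) p.1 p.2 := by
    rintro ⟨r, c⟩ -
    obtain ⟨j, -, hj⟩ := Finset.exists_ne_zero_of_sum_ne_zero ((hsum r c).trans_ne one_ne_zero)
    exact Finset.mem_biUnion.2 ⟨j, Finset.mem_univ j, mem_supp.2 hj⟩
  have h1 := (Finset.card_le_card hcover).trans (Finset.card_biUnion_le_card_mul _ _ 4
    fun j _ => card_ones_spreadMatrix_le hC hd (0, j))
  simp only [Finset.card_univ, Fintype.card_prod, Fintype.card_fin] at h1
  nlinarith

end CCZCircuit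

end BaconShor

end

theorem mainTheorem2 (m n : ℕ) [NeZero m] [NeZero n] :
    (m ≤ n → ⌈(m : ℚ) / 2⌉₊ ^ 2 ≤ n →
      ∃ C : BaconShor.CCZCircuit m n,
        C.NoRepeatedGate ∧ C.ImplementsLogicalCCZ ∧ C.HasEffectiveDistanceSPR m) ∧
    ((∃ C : BaconShor.CCZCircuit m n,
        C.ImplementsLogicalCCZ ∧ C.HasEffectiveDistanceSPR m) →
      ⌈(m : ℚ) ^ 2 / 4⌉₊ ≤ n) := by
  constructor
  · intro hmn hn
    have hm : m ≤ 2 * ⌈(m : ℚ) / 2⌉₊ := by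
      have h := Nat.le_ceil ((m : ℚ) / 2)
      have h' : (m : ℚ) ≤ 2 * (⌈(m : ℚ) / 2⌉₊ : ℚ) := by linarith
      exact_mod_cast h'
    exact ⟨BaconShor.CCZCircuit.pairCircuit hm hn,
      BaconShor.CCZCircuit.pairCircuit_noRepeatedGate hm hn,
      BaconShor.CCZCircuit.pairCircuit_implementsLogicalCCZ hm hn,
      (BaconShor.CCZCircuit.pairCircuit_pairLocal hm hn).hasEffectiveDistanceSPR hmn⟩
  · rintro ⟨C, hC, hd⟩
    have h := BaconShor.CCZCircuit.sq_le_four_mul hC hd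
    rw [Nat.ceil_le, div_le_iff₀ (by norm_num)]
    exact_mod_cast h.trans_eq (mul_comm 4 n)
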